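/- Let $\Omega\subset\mathbb{C}$ be a bounded domain (a bounded, non-empty, connected open set), and let $$E_\Omega(z,\overline{w})=\exp\Bigl(\frac{-1}{\pi}\int_\Omega\frac{dA(\zeta)}{(\zeta-z)(\overline{\zeta}-\overline{w})}\Bigr),\qquad z,w\in\mathbb{C}\setminus\overline{\Omega},$$ where $dA$ is planar Lebesgue measure. A function $F(z,\overline{w})$ is called analytic in $z,\overline{w}$ for $z,w\in U$ if $F(z,v)$ is holomorphic in the two variables $(z,v)$ for $z\in U$, $\overline{v}\in U$. Let $\lambda\in\partial\Omega$ be a point near which $\partial\Omega$ is a smooth real analytic curve; that is, for some open neighbourhood $V$ of $\lambda$, the set $V\cap\partial\Omega$ is the homeomorphic image of an open interval under a real analytic map with nowhere vanishing derivative. Then there is a connected open neighbourhood $U$ of $\lambda$ in $\mathbb{C}$ such that the following hold. 1. $E_\Omega(z,\overline{w})$ extends from $z,w\in U\setminus\overline{\Omega}$ to a function $E'_\Omega(z,\overline{w})$ analytic in $z,\overline{w}$ for $z,w\in U$. This extension is unique if $U\setminus\overline{\Omega}\neq\emptyset$ (which is automatic when $\Omega=\operatorname{int}\overline{\Omega}$).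 2. The Schwarz reflection $w\mapsto w^*$ in $U\cap\partial\Omega$ is defined on $U$, i.e. there is an anti-analytic function $w\mapsto w^*$ on $U$ (necessarily unique) with $w^*=w$ for $w\in U\cap\partial\Omega$. Moreover, there is a function $f(z,\overline{w})$, analytic in $z,\overline{w}$ and without zeros for $z,w\in U$, such that, if $U\setminus\overline{\Omega}\neq\emptyset$, the extension satisfies $$E'_\Omega(z,\overline{w})=(z-w^*)\,f(z,\overline{w}),\qquad z,w\in U.$$ If $U\setminus\overline{\Omega}=\emptyset$, some extension $E'_\Omega$ satisfies this identity. -/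

import Mathlib

open scoped ComplexConjugate

/-- The exponential kernel
`E_Ω(z, v) = exp (-(1/π) ∫_Ω dA(ζ) / ((ζ - z) (conj ζ - v)))`.
The second slot carries the conjugated variable: `E_Ω(z, w̄)` is `expKernel Ω z (conj w)`. -/
noncomputable def expKernel (Ω : Set ℂ) (z v : ℂ) : ℂ :=
  Complex.exp (-(1 / (Real.pi : ℂ)) *
    ∫ ζ in Ω, 1 / ((ζ - z) * (conj ζ - v)) ∂MeasureTheory.volume)

/-- `F(z, w̄)` is analytic in `z, w̄` for `z, w ∈ U`: the function `F` of two independent complex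
variables is holomorphic at every point `(z, v)` with `z ∈ U` and `v = w̄`, `w ∈ U`. -/
def AnalyticInConj (F : ℂ → ℂ → ℂ) (U : Set ℂ) : Prop :=
  AnalyticOnNhd ℂ (fun p : ℂ × ℂ => F p.1 p.2) {p : ℂ × ℂ | p.1 ∈ U ∧ conj p.2 ∈ U}

/-- `F(z, w̄)` is an analytic extension of `E_Ω(z, w̄)` from `z, w ∈ U \ closure Ω` to
`z, w ∈ U`. -/
structure IsAnalyticExtension (Ω U : Set ℂ) (F : ℂ → ℂ → ℂ) : Prop where
  analytic : AnalyticInConj F U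
  eq_kernel : ∀ z ∈ U \ closure Ω, ∀ w ∈ U \ closure Ω,
    F z (conj w) = expKernel Ω z (conj w)

/-- Near the point `p`, the set `S` is a smooth real analytic curve: for some open `V ∋ p`, the set
`S ∩ V` is the homeomorphic image of an open interval under a real analytic map with nowhere
vanishing derivative. -/
def IsSmoothAnalyticCurveNear (S : Set ℂ) (p : ℂ) : Prop :=
  ∃ V : Set ℂ, IsOpen V ∧ p ∈ V ∧ ∃ (a b : ℝ) (γ : ℝ → ℂ),
    AnalyticOnNhd ℝ γ (Set.Ioo a b) ∧
    (∀ t ∈ Set.Ioo a b, deriv γ t ≠ 0) ∧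
    Topology.IsEmbedding ((Set.Ioo a b).domRestrict γ) ∧
    γ '' Set.Ioo a b = S ∩ V

/-- `σ` is the Schwarz reflection in `U ∩ Γ`, defined on `U`: it is anti-analytic on `U` (its
conjugate, the Schwarz function, is analytic) and fixes the points of `U ∩ Γ`. If `U` is connected
and `U ∩ Γ` has an accumulation point in `U`, these properties determine `σ` on `U`. -/
structure IsSchwarzReflection (Γ U : Set ℂ) (σ : ℂ → ℂ) : Prop where
  antianalytic : AnalyticOnNhd ℂ (fun z => conj (σ z)) U
  fixes : ∀ z ∈ U ∩ Γ, σ z = z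

open MeasureTheory Topology Set

/-! A conformal coordinate `φ` on a disc about `0` straightens the boundary arc to the real axis, so
that the Schwarz reflection becomes `φ s ↦ φ (conj s)`. Each open half disc is mapped into `Ω` or
into the complement of its closure. Both cannot be exterior, since the centre is a boundary point of
`Ω`. If both are interior, there is no exterior point nearby and `z - w*` serves as the extension.
There remains the case where, after possibly replacing `s` by `-s`, the upper half is interior and
the lower half exterior.

Put `ψ = conjConj φ`, `z = φ a`, `conj w = ψ b`. For exterior points `Im a < 0 < Im b`, and `w* = φ
b`. The part of the area integral over a thin rectangle on the axis becomes a double integral of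
`φ'(s) ψ'(u) / ((φ s - φ a) (ψ u - ψ b))` with `s = x + iy`, `u = x - iy`. For fixed `y` this is
meromorphic in `x`, with a pole at `a - iy` below the axis and one at `b + iy` above it. Pushing the
segment of integration up to the three remaining sides of a rectangle crosses only the second pole,
with residue `φ'(b + 2iy) / (φ (b + 2iy) - φ a)` (`integral_conformalKernel_shift`).

Integrated over `y`, the residues form a logarithmic derivative. After multiplication by `-1/π` and
exponentiation they give `(φ b - φ a) / (φ (b + 2ir) - φ a)`
(`IsConformalOn.exp_sweepIntegral_base`). The numerator is `w* - z`, the only source of a zero. The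
integrals over the three sides and over the rest of `Ω` are double Cauchy transforms whose data stay
away from `z` and `w`, so they are analytic across the arc (`analyticAt_integral_div_sub_mul_sub`),
and their exponentials do not vanish. -/

/-! ### Analytic dependence of double Cauchy transforms -/

theorem ContinuousMap.ringInverse_apply {X : Type*} [TopologicalSpace X] [CompactSpace X]
    (u : C(X, ℂ)) (hu : ∀ x, u x ≠ 0) (x : X) : (Ring.inverse u) x = (u x)⁻¹ := by
  have h1 : IsUnit u := ContinuousMap.isUnit_iff_forall_ne_zero u |>.2 hu
  have h2 := congrArg (fun f : C(X, ℂ) => f x) (Ring.mul_inverse_cancel u h1)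
  simp only [ContinuousMap.mul_apply, ContinuousMap.one_apply] at h2
  exact eq_inv_of_mul_eq_one_right h2

/-- Integration against a finite measure, as a continuous linear functional on `C(X, ℂ)`. -/
noncomputable def ContinuousMap.integralFunctional {X : Type*} [TopologicalSpace X]
    [CompactSpace X] [MeasurableSpace X] [OpensMeasurableSpace X] (μ : Measure X)
    [IsFiniteMeasure μ] : C(X, ℂ) →L[ℂ] ℂ :=
  LinearMap.mkContinuous
    { toFun := fun f => ∫ x, f x ∂μ
      map_add' := fun f g => by
        have h : ∀ f : C(X, ℂ), Integrable f μ := fun f =>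
          (BoundedContinuousFunction.mkOfCompact f).integrable μ
        simpa using integral_add (h f) (h g)
      map_smul' := fun c f => by simpa using integral_const_mul c (fun x => f x) }
    (μ.real univ) (fun f => by
      have := norm_integral_le_of_norm_le_const (μ := μ)
        (Filter.Eventually.of_forall (fun x => f.norm_coe_le_norm x))
      simpa [mul_comm] using this)

theorem ContinuousMap.integralFunctional_apply {X : Type*} [TopologicalSpace X]
    [CompactSpace X] [MeasurableSpace X] [OpensMeasurableSpace X] (μ : Measure X)
    [IsFiniteMeasure μ] (f : C(X, ℂ)) :
    ContinuousMap.integralFunctional μ f = ∫ x, f x ∂μ := rfl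

/-- Double Cauchy transforms of continuous data on a compact set are jointly analytic away from
the data. -/
theorem analyticAt_integral_div_sub_mul_sub {X : Type*} [TopologicalSpace X] [MeasurableSpace X]
    [OpensMeasurableSpace X] {μ : Measure X} {K : Set X} (hK : IsCompact K)
    (hKm : MeasurableSet K) (hμ : μ K ≠ ⊤) {p q g : X → ℂ} (hp : ContinuousOn p K)
    (hq : ContinuousOn q K) (hg : ContinuousOn g K) {z v : ℂ} (hz : z ∉ p '' K)
    (hv : v ∉ q '' K) :
    AnalyticAt ℂ (fun w : ℂ × ℂ => ∫ x in K, g x / ((p x - w.1) * (q x - w.2)) ∂μ) (z, v) := by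
  have : CompactSpace K := isCompact_iff_compactSpace.1 hK
  have : IsFiniteMeasure (μ.comap ((↑) : K → X)) := by
    refine ⟨?_⟩
    rw [(MeasurableEmbedding.subtype_coe hKm).comap_apply]
    simpa using hμ.lt_top
  let P : C(K, ℂ) := ⟨K.domRestrict p, hp.domRestrict⟩
  let Q : C(K, ℂ) := ⟨K.domRestrict q, hq.domRestrict⟩
  let G : C(K, ℂ) := ⟨K.domRestrict g, hg.domRestrict⟩
  -- The integrand is regarded as a point of the Banach algebra `C(K, ℂ)`. Inversion is analytic at
  -- units and integration is continuous and linear, so no differentiation under the integral is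
  -- needed.
  let H : ℂ × ℂ → C(K, ℂ) := fun w =>
    G * (Ring.inverse (P - w.1 • (1 : C(K, ℂ))) * Ring.inverse (Q - w.2 • (1 : C(K, ℂ))))
  have key : ∀ (A : C(K, ℂ)) (c : ℂ), (∀ x, A x ≠ c) →
      ∀ x, (A - c • (1 : C(K, ℂ))) x ≠ 0 := by
    intro A c h x
    simpa [sub_eq_zero] using h x
  have hz' : ∀ w ∉ p '' K, ∀ x, P x ≠ w := fun w hw x hx => hw ⟨x, x.2, hx⟩
  have hv' : ∀ w ∉ q '' K, ∀ x, Q x ≠ w := fun w hw x hx => hw ⟨x, x.2, hx⟩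
  have hH : AnalyticAt ℂ H (z, v) := by
    have inv : ∀ (A : C(K, ℂ)) (c : ℂ), (∀ x, A x ≠ c) →
        AnalyticAt ℂ Ring.inverse (A - c • (1 : C(K, ℂ))) := by
      intro A c h
      have hu := (ContinuousMap.isUnit_iff_forall_ne_zero _).2 (key A c h)
      exact analyticAt_inverse (𝕜 := ℂ) hu.unit
    have a1 : AnalyticAt ℂ (fun w : ℂ × ℂ => P - w.1 • (1 : C(K, ℂ))) (z, v) :=
      analyticAt_const.sub (analyticAt_fst.smul analyticAt_const)
    have a2 : AnalyticAt ℂ (fun w : ℂ × ℂ => Q - w.2 • (1 : C(K, ℂ))) (z, v) :=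
      analyticAt_const.sub (analyticAt_snd.smul analyticAt_const)
    have b1 := AnalyticAt.comp_of_eq (inv P z (hz' z hz)) a1 rfl
    have b2 := AnalyticAt.comp_of_eq (inv Q v (hv' v hv)) a2 rfl
    exact analyticAt_const.mul (b1.mul b2)
  have hT := ((ContinuousMap.integralFunctional (μ.comap ((↑) : K → X))).analyticAt
    (H (z, v))).fun_comp hH
  refine hT.congr ?_
  have o1 : ∀ᶠ w : ℂ × ℂ in 𝓝 (z, v), w.1 ∉ p '' K :=
    (continuousAt_fst (p := (z, v))).eventually ((hK.image_of_continuousOn hp).isClosed.isOpen_compl.mem_nhds hz)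
  have o2 : ∀ᶠ w : ℂ × ℂ in 𝓝 (z, v), w.2 ∉ q '' K :=
    (continuousAt_snd (p := (z, v))).eventually ((hK.image_of_continuousOn hq).isClosed.isOpen_compl.mem_nhds hv)
  filter_upwards [o1, o2] with w h1 h2
  rw [ContinuousMap.integralFunctional_apply, ← integral_subtype_comap hKm]
  refine integral_congr_ae (Filter.Eventually.of_forall fun x => ?_)
  simp only [H, ContinuousMap.mul_apply]
  rw [ContinuousMap.ringInverse_apply _ (key P _ (hz' _ h1)),
    ContinuousMap.ringInverse_apply _ (key Q _ (hv' _ h2))]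
  have e1 : P x = p x := rfl
  have e2 : Q x = q x := rfl
  have e3 : G x = g x := rfl
  simp [e1, e2, e3, div_eq_mul_inv, mul_comm]

/-! ### Cauchy's formula on a rectangle and logarithmic derivatives -/

theorem Complex.log_neg_I_mul_of_re_pos {u : ℂ} (hu : 0 < u.re) :
    Complex.log (-Complex.I * u) = Complex.log u - Real.pi / 2 * Complex.I := by
  have hu0 : u ≠ 0 := by rintro rfl; simp at hu
  have h := abs_lt.1 (Complex.abs_arg_lt_pi_div_two_iff.2 (Or.inl hu))
  rw [Complex.log_mul (by simp) hu0]
  · rw [Complex.log_neg_I]; ring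
  · rw [Complex.arg_neg_I]
    constructor <;> linarith [Real.pi_pos, h.1, h.2]

/-- Between the right half plane and the third quadrant the two branches change their difference by
`2πi`: this jump is the winding number of the rectangle. -/
theorem Complex.log_neg_I_mul_of_re_neg_of_im_neg {u : ℂ} (hu : u.re < 0) (hu' : u.im < 0) :
    Complex.log (-Complex.I * u) = Complex.log u + 3 * Real.pi / 2 * Complex.I := by
  have hu0 : -u ≠ 0 := by intro h; simp [neg_eq_zero.1 h] at hu
  have h := abs_lt.1 (Complex.abs_arg_lt_pi_div_two_iff.2
    (Or.inl (show 0 < (-u).re by simpa using hu)))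
  have e : -Complex.I * u = Complex.I * (-u) := by ring
  have e2 : Complex.log (-u) = Complex.log u + Real.pi * Complex.I := by
    apply Complex.ext
    · simp [Complex.log_re]
    · simp [Complex.log_im, Complex.arg_neg_eq_arg_add_pi_of_im_neg hu']
  rw [e, Complex.log_mul (by simp) hu0, e2]
  · rw [Complex.log_I]; ring
  · rw [Complex.arg_I]
    constructor <;> linarith [Real.pi_pos, h.1, h.2]

theorem Complex.neg_I_mul_mem_slitPlane {u : ℂ} (hu : 0 < u.im ∨ u.re ≠ 0) :
    -Complex.I * u ∈ Complex.slitPlane := by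
  rw [Complex.mem_slitPlane_iff]
  simpa using hu

/-- The factor `κ` rotates the branch cut off the segment and cancels in the logarithmic derivative.
-/
theorem integral_inv_eq_log_sub {e : ℝ → ℂ} {e' κ : ℂ} (hκ : κ ≠ 0) {c d : ℝ}
    (he : ∀ t, HasDerivAt e e' t) (hs : ∀ t ∈ uIcc c d, κ * e t ∈ Complex.slitPlane) :
    e' * ∫ t in c..d, 1 / e t = Complex.log (κ * e d) - Complex.log (κ * e c) := by
  have hec : Continuous e := continuous_iff_continuousAt.2 fun t => (he t).continuousAt
  have hne : ∀ t ∈ uIcc c d, e t ≠ 0 := fun t ht h0 => by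
    have := hs t ht
    simp [h0] at this
  rw [← intervalIntegral.integral_const_mul]
  refine intervalIntegral.integral_eq_sub_of_hasDerivAt
    (f := fun t => Complex.log (κ * e t)) (fun t ht => ?_) ?_
  · have h := ((he t).const_mul κ).clog_real (hs t ht)
    have := hne t ht
    exact h.congr_deriv (by field_simp)
  · refine ContinuousOn.intervalIntegrable ?_
    exact continuousOn_const.mul (continuousOn_const.div hec.continuousOn hne)

/-- The integral of `1 / (x - β)` over the boundary of a rectangle around `β`. -/
theorem integral_boundary_rect_inv_sub {ρ δ : ℝ} {β : ℂ} (hre : |β.re| < ρ) (h0 : 0 < β.im)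
    (h1 : β.im < δ) :
    (∫ x in (-ρ)..ρ, 1 / ((x : ℂ) - β)) - (∫ x in (-ρ)..ρ, 1 / ((x : ℂ) + δ * Complex.I - β)) +
      Complex.I * (∫ y in (0 : ℝ)..δ, 1 / ((ρ : ℂ) + y * Complex.I - β)) -
      Complex.I * (∫ y in (0 : ℝ)..δ, 1 / (-(ρ : ℂ) + y * Complex.I - β)) =
      2 * Real.pi * Complex.I := by
  obtain ⟨hl, hr⟩ := abs_lt.1 hre
  have hI : -Complex.I ≠ 0 := by simp
  have dx : ∀ (c : ℂ) (t : ℝ), HasDerivAt (fun t : ℝ => (t : ℂ) + c) 1 t := fun c t =>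
    (Complex.ofRealCLM.hasDerivAt (x := t)).add_const c
  have dy : ∀ (c : ℂ) (t : ℝ), HasDerivAt (fun t : ℝ => c + t * Complex.I) Complex.I t :=
    fun c t => by
      simpa using ((Complex.ofRealCLM.hasDerivAt (x := t)).mul_const Complex.I).const_add c
  -- Seen from `β`, the lower side avoids the negative real axis and the other three avoid the
  -- negative imaginary axis. The principal branch serves the former, the branch turned by `-I` the
  -- latter. They meet at the two lower corners.
  have b := integral_inv_eq_log_sub one_ne_zero (c := -ρ) (d := ρ) (dx (-β)) (fun t _ => by
    rw [Complex.mem_slitPlane_iff]; right; simp; linarith)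
  have t := integral_inv_eq_log_sub hI (c := -ρ) (d := ρ) (dx (δ * Complex.I - β)) (fun t _ =>
    Complex.neg_I_mul_mem_slitPlane (by left; simp; linarith))
  have r := integral_inv_eq_log_sub hI (c := 0) (d := δ) (dy (ρ - β)) (fun t _ =>
    Complex.neg_I_mul_mem_slitPlane (by right; simp; intro h; linarith))
  have l := integral_inv_eq_log_sub hI (c := 0) (d := δ) (dy (-ρ - β)) (fun t _ =>
    Complex.neg_I_mul_mem_slitPlane (by right; simp; intro h; linarith))
  have c1 := Complex.log_neg_I_mul_of_re_pos (u := ρ - β) (by simp; linarith)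
  have c2 := Complex.log_neg_I_mul_of_re_neg_of_im_neg (u := -ρ - β) (by simp; linarith)
    (by simp; linarith)
  have e1 : ∀ x : ℝ, (x : ℂ) + -β = x - β := fun x => by ring
  have e2 : ∀ x : ℝ, (x : ℂ) + (δ * Complex.I - β) = x + δ * Complex.I - β := fun x => by ring
  have e3 : ∀ x : ℝ, (ρ : ℂ) - β + x * Complex.I = ρ + x * Complex.I - β := fun x => by ring
  have e4 : ∀ x : ℝ, -(ρ : ℂ) - β + x * Complex.I = -ρ + x * Complex.I - β := fun x => by ring
  simp only [e1, e2, e3, e4, one_mul, Complex.ofReal_neg, Complex.ofReal_zero, zero_mul,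
    add_zero] at b t r l
  rw [b, t, r, l, c1, c2]
  ring

theorem intervalIntegral_div_sub_eq_dslope {S : Set ℂ} (hS : IsOpen S) {G : ℂ → ℂ}
    (hG : DifferentiableOn ℂ G S) {β : ℂ} (hβ : β ∈ S) {e : ℝ → ℂ} (he : Continuous e) {c d : ℝ}
    (heS : ∀ t ∈ uIcc c d, e t ∈ S) (hne : ∀ t ∈ uIcc c d, e t ≠ β) :
    ∫ t in c..d, G (e t) / (e t - β) =
      (∫ t in c..d, dslope G β (e t)) + G β * ∫ t in c..d, 1 / (e t - β) := by
  have hd : ContinuousOn (dslope G β) S := (continuousOn_dslope (hS.mem_nhds hβ)).2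
    ⟨hG.continuousOn, hG.differentiableAt (hS.mem_nhds hβ)⟩
  rw [← intervalIntegral.integral_const_mul, ← intervalIntegral.integral_add]
  · refine intervalIntegral.integral_congr fun t ht => ?_
    have h := sub_ne_zero.2 (hne t ht)
    simp only [dslope_of_ne _ (hne t ht), slope_def_field]
    field_simp
    ring_nf
  · exact (hd.comp he.continuousOn heS).intervalIntegrable
  · refine ContinuousOn.intervalIntegrable (continuousOn_const.mul (continuousOn_const.div ?_ ?_))
    · exact (he.sub continuous_const).continuousOn
    · exact fun t ht => sub_ne_zero.2 (hne t ht)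

/-- **Cauchy's integral formula for a rectangle**, solved for the integral over the lower side. -/
theorem integral_lower_side_div_sub {S : Set ℂ} (hS : IsOpen S) {G : ℂ → ℂ}
    (hG : DifferentiableOn ℂ G S) {ρ δ : ℝ} {β : ℂ} (hre : |β.re| < ρ) (h0 : 0 < β.im)
    (h1 : β.im < δ) (hsub : Icc (-ρ) ρ ×ℂ Icc 0 δ ⊆ S) :
    ∫ x in (-ρ)..ρ, G x / ((x : ℂ) - β) =
      (∫ x in (-ρ)..ρ, G (x + δ * Complex.I) / ((x : ℂ) + δ * Complex.I - β)) -
      Complex.I * (∫ y in (0 : ℝ)..δ,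
        G (ρ + y * Complex.I) / ((ρ : ℂ) + y * Complex.I - β)) +
      Complex.I * (∫ y in (0 : ℝ)..δ,
        G (-ρ + y * Complex.I) / (-(ρ : ℂ) + y * Complex.I - β)) +
      2 * Real.pi * Complex.I * G β := by
  obtain ⟨hl, hr⟩ := abs_lt.1 hre
  have hρ : -ρ ≤ ρ := by linarith
  have hδ : 0 ≤ δ := by linarith
  have hβ : β ∈ S := hsub (Complex.mem_reProdIm.2 ⟨⟨hl.le, hr.le⟩, ⟨h0.le, h1.le⟩⟩)
  have hd : ContinuousOn (dslope G β) S := (continuousOn_dslope (hS.mem_nhds hβ)).2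
    ⟨hG.continuousOn, hG.differentiableAt (hS.mem_nhds hβ)⟩
  -- Subtracting the pole leaves `dslope G β`. Its continuity at `β` is enough, because Cauchy's
  -- theorem tolerates a countable exceptional set.
  have hz := Complex.integral_boundary_rect_eq_zero_of_differentiable_on_off_countable
    (dslope G β) ((-ρ : ℝ) : ℂ) (ρ + δ * Complex.I) {β} (countable_singleton β)
    (hd.mono (by simpa [uIcc_of_le hρ, uIcc_of_le hδ] using hsub))
    (fun x hx => by
      have hx1 : x ∈ S := hsub (by
        have := hx.1
        simp only [Complex.ofReal_re, Complex.add_re, Complex.mul_re, Complex.I_re, mul_zero,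
          Complex.ofReal_im, Complex.I_im, mul_one, sub_self, add_zero, Complex.add_im,
          Complex.mul_im, zero_add, min_eq_left hρ, max_eq_right hρ, min_eq_left hδ,
          max_eq_right hδ] at this
        exact ⟨⟨this.1.1.le, this.1.2.le⟩, ⟨this.2.1.le, this.2.2.le⟩⟩)
      exact (differentiableAt_dslope_of_ne hx.2).2 (hG.differentiableAt (hS.mem_nhds hx1)))
  have hc := integral_boundary_rect_inv_sub hre h0 h1
  have b := intervalIntegral_div_sub_eq_dslope hS hG hβ (e := fun x => (x : ℂ)) (c := -ρ) (d := ρ)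
    (by fun_prop)
    (fun t ht => hsub (by
      rw [uIcc_of_le hρ] at ht
      simpa [Complex.mem_reProdIm] using ⟨ht, hδ⟩))
    (fun t _ h => by simp [← h] at h0)
  have t := intervalIntegral_div_sub_eq_dslope hS hG hβ (e := fun x => (x : ℂ) + δ * Complex.I)
    (c := -ρ) (d := ρ) (by fun_prop)
    (fun t ht => hsub (by
      rw [uIcc_of_le hρ] at ht
      simpa [Complex.mem_reProdIm] using ⟨ht, hδ⟩))
    (fun t _ h => by simp [← h] at h1)
  have r := intervalIntegral_div_sub_eq_dslope hS hG hβ (e := fun y => (ρ : ℂ) + y * Complex.I)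
    (c := 0) (d := δ) (by fun_prop)
    (fun t ht => hsub (by
      rw [uIcc_of_le hδ] at ht
      simpa [Complex.mem_reProdIm, hρ] using ht))
    (fun t _ h => by simp [← h] at hr)
  have l := intervalIntegral_div_sub_eq_dslope hS hG hβ (e := fun y => -(ρ : ℂ) + y * Complex.I)
    (c := 0) (d := δ) (by fun_prop)
    (fun t ht => hsub (by
      rw [uIcc_of_le hδ] at ht
      simpa [Complex.mem_reProdIm, hρ] using ht))
    (fun t _ h => by simp [← h] at hl)
  simp at hz
  rw [b, t, r, l]
  linear_combination hz + G β * hc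

/-- The exponential of the integral of a logarithmic derivative. -/
theorem exp_neg_integral_logDeriv {q q' : ℝ → ℂ} {r : ℝ} (hr : 0 ≤ r)
    (hq : ∀ y ∈ Icc 0 r, HasDerivAt q (q' y) y) (hq' : ContinuousOn q' (Icc 0 r))
    (hne : ∀ y ∈ Icc 0 r, q y ≠ 0) :
    Complex.exp (-∫ y in (0 : ℝ)..r, q' y / q y) = q 0 / q r := by
  have hqc : ContinuousOn q (Icc 0 r) := fun y hy => (hq y hy).continuousAt.continuousWithinAt
  have hc : ContinuousOn (fun y => q' y / q y) (Icc 0 r) := hq'.div hqc hne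
  -- This product has zero derivative, so no branch of `log q` along the path has to be chosen.
  let Φ : ℝ → ℂ := fun s => q s * Complex.exp (-∫ y in (0 : ℝ)..s, q' y / q y)
  have hint : ∀ s ∈ Icc 0 r, IntervalIntegrable (fun y => q' y / q y) volume 0 s := fun s hs =>
    (hc.mono (by rw [uIcc_of_le hs.1]; exact Icc_subset_Icc_right hs.2)).intervalIntegrable
  have hprim : ContinuousOn (fun s => ∫ y in (0 : ℝ)..s, q' y / q y) (Icc 0 r) := by
    have := intervalIntegral.continuousOn_primitive_interval (μ := volume)
      (f := fun y => q' y / q y) (a := 0) (b := r)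
      (by rw [uIcc_of_le hr]; exact hc.integrableOn_Icc)
    rwa [uIcc_of_le hr] at this
  have hΦ : ∀ x ∈ Icc 0 r, Φ x = Φ 0 := by
    refine constant_of_has_deriv_right_zero ?_ fun x hx => ?_
    · exact hqc.mul (hprim.neg.cexp)
    · have hx' : x ∈ Icc 0 r := ⟨hx.1, hx.2.le⟩
      have hcx : ContinuousWithinAt (fun y => q' y / q y) (Ici x) x :=
        (hc x hx').mono_of_mem_nhdsWithin
          (Filter.mem_of_superset (Icc_mem_nhdsGE hx.2) (Icc_subset_Icc_left hx.1))
      have hsm : StronglyMeasurableAtFilter (fun y => q' y / q y) (𝓝[>] x) volume :=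
        ⟨Ioo x r, Ioo_mem_nhdsGT hx.2, (hc.mono (fun y hy =>
          ⟨hx.1.trans hy.1.le, hy.2.le⟩)).aestronglyMeasurable measurableSet_Ioo⟩
      have h1 := intervalIntegral.integral_hasDerivWithinAt_right (hint x hx') (s := Ici x)
        (t := Ioi x) hsm (hcx.mono Ioi_subset_Ici_self)
      have h2 := (hq x hx').hasDerivWithinAt (s := Ici x)
      have h3 := h2.mul h1.neg.cexp
      have h0 := hne x hx'
      exact h3.congr_deriv (by field_simp; ring_nf)
  have h := hΦ r ⟨hr, le_rfl⟩
  simp only [Φ, intervalIntegral.integral_same, neg_zero, Complex.exp_zero, mul_one] at h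
  rw [← h, mul_div_cancel_left₀ _ (hne r ⟨hr, le_rfl⟩)]

/-! ### Conformal coordinates and the contour shift -/

/-- `φ` is a conformal map of `B` onto its image. -/
structure IsConformalOn (φ : ℂ → ℂ) (B : Set ℂ) : Prop where
  differentiableOn : DifferentiableOn ℂ φ B
  injOn : InjOn φ B
  deriv_ne_zero : ∀ s ∈ B, deriv φ s ≠ 0

theorem Complex.mem_ball_zero_of_abs_le {s : ℂ} {A B R : ℝ} (h1 : |s.re| ≤ A) (h2 : |s.im| ≤ B)
    (h : A + B < R) : s ∈ Metric.ball (0 : ℂ) R := by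
  rw [mem_ball_zero_iff]
  linarith [Complex.norm_le_abs_re_add_abs_im s]

theorem IsConformalOn.dslope_ne_zero {ψ : ℂ → ℂ} {B : Set ℂ} (hψ : IsConformalOn ψ B) {b u : ℂ}
    (hb : b ∈ B) (hu : u ∈ B) : dslope ψ b u ≠ 0 := by
  by_cases h : u = b
  · rw [h, dslope_same]
    exact hψ.deriv_ne_zero b hb
  · rw [dslope_of_ne _ h, slope_def_field]
    exact div_ne_zero (sub_ne_zero.2 fun e => h (hψ.injOn hu hb e)) (sub_ne_zero.2 h)

/-- The integrand of the area integral defining the exponential kernel, in conformal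
coordinates, with independent holomorphic variables `s` and `u` in place of `s` and `conj s`. -/
noncomputable def conformalKernel (φ ψ : ℂ → ℂ) (z v s u : ℂ) : ℂ :=
  deriv φ s * deriv ψ u / ((φ s - z) * (ψ u - v))

/-- Shifting the line of integration upwards across the pole of the kernel at `b + i y`. -/
theorem integral_conformalKernel_shift {φ ψ : ℂ → ℂ} {r R y : ℝ}
    (hφ : IsConformalOn φ (Metric.ball 0 R)) (hψ : IsConformalOn ψ (Metric.ball 0 R))
    (hR : 10 * r ≤ R) {a b : ℂ} (ha : a ∈ Metric.ball 0 r) (hb : b ∈ Metric.ball 0 r)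
    (ha' : a.im < 0) (hb' : 0 < b.im) (hy : y ∈ Icc 0 r) :
    ∫ x in (-(2 * r))..(2 * r),
        conformalKernel φ ψ (φ a) (ψ b) (x + y * Complex.I) (x - y * Complex.I) =
      (∫ x in (-(2 * r))..(2 * r), conformalKernel φ ψ (φ a) (ψ b)
        (x + (2 * r : ℝ) * Complex.I + y * Complex.I)
        (x + (2 * r : ℝ) * Complex.I - y * Complex.I)) -
      Complex.I * (∫ t in (0 : ℝ)..(2 * r), conformalKernel φ ψ (φ a) (ψ b)
        ((2 * r : ℝ) + t * Complex.I + y * Complex.I)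
        ((2 * r : ℝ) + t * Complex.I - y * Complex.I)) +
      Complex.I * (∫ t in (0 : ℝ)..(2 * r), conformalKernel φ ψ (φ a) (ψ b)
        (-(2 * r : ℝ) + t * Complex.I + y * Complex.I)
        (-(2 * r : ℝ) + t * Complex.I - y * Complex.I)) +
      2 * Real.pi * Complex.I *
        (deriv φ (b + 2 * y * Complex.I) / (φ (b + 2 * y * Complex.I) - φ a)) := by
  rw [mem_ball_zero_iff] at ha hb
  obtain ⟨hy0, hyr⟩ := hy
  have har := (Complex.abs_re_le_norm a).trans_lt ha
  have hai := (Complex.abs_im_le_norm a).trans_lt ha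
  have hbr := (Complex.abs_re_le_norm b).trans_lt hb
  have hbi := (Complex.abs_im_le_norm b).trans_lt hb
  rw [abs_lt] at har hai hbr hbi
  have haR : a ∈ Metric.ball (0 : ℂ) R := by rw [mem_ball_zero_iff]; linarith
  have hbR : b ∈ Metric.ball (0 : ℂ) R := by rw [mem_ball_zero_iff]; linarith
  have hB : IsOpen (Metric.ball (0 : ℂ) R) := Metric.isOpen_ball
  -- The last condition removes the pole of the `φ` factor. The rectangle avoids it because `Im a <
  -- 0 ≤ y`.
  set S : Set ℂ := {x | x + y * Complex.I ∈ Metric.ball (0 : ℂ) R ∧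
    x - y * Complex.I ∈ Metric.ball (0 : ℂ) R ∧ x + y * Complex.I ≠ a} with hSdef
  have cp : Continuous fun x : ℂ => x + y * Complex.I := by fun_prop
  have cm : Continuous fun x : ℂ => x - y * Complex.I := by fun_prop
  have hS : IsOpen S := (hB.preimage cp).inter ((hB.preimage cm).inter
    (isOpen_compl_singleton.preimage cp))
  have hdsl : DifferentiableOn ℂ (dslope ψ b) (Metric.ball 0 R) :=
    (Complex.differentiableOn_dslope (hB.mem_nhds hbR)).2 hψ.differentiableOn
  have mp : MapsTo (fun x : ℂ => x + y * Complex.I) S (Metric.ball 0 R) := fun x hx => hx.1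
  have mm : MapsTo (fun x : ℂ => x - y * Complex.I) S (Metric.ball 0 R) := fun x hx => hx.2.1
  have dp : DifferentiableOn ℂ (fun x : ℂ => x + y * Complex.I) S := by fun_prop
  have dm : DifferentiableOn ℂ (fun x : ℂ => x - y * Complex.I) S := by fun_prop
  have hφne : ∀ x ∈ S, φ (x + y * Complex.I) - φ a ≠ 0 := fun x hx =>
    sub_ne_zero.2 fun e => hx.2.2 (hφ.injOn hx.1 haR e)
  -- Replacing `ψ u - ψ b` by the zero-free `dslope ψ b u` splits off the simple pole at `x = b +
  -- iy`. At that point the factor is `deriv ψ b`, which cancels the numerator.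
  set G : ℂ → ℂ := fun x => deriv φ (x + y * Complex.I) * deriv ψ (x - y * Complex.I) /
    ((φ (x + y * Complex.I) - φ a) * dslope ψ b (x - y * Complex.I)) with hGdef
  have hG : DifferentiableOn ℂ G S := by
    refine DifferentiableOn.div ?_ ?_ fun x hx => ?_
    · exact ((hφ.differentiableOn.deriv hB).comp dp mp).mul
        ((hψ.differentiableOn.deriv hB).comp dm mm)
    · exact ((hφ.differentiableOn.comp dp mp).sub_const _).mul (hdsl.comp dm mm)
    · exact mul_ne_zero (hφne x hx) (hψ.dslope_ne_zero hbR hx.2.1)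
  have hGk : ∀ x : ℂ, x ≠ b + y * Complex.I → G x / (x - (b + y * Complex.I)) =
      conformalKernel φ ψ (φ a) (ψ b) (x + y * Complex.I) (x - y * Complex.I) := by
    intro x hx
    have hx' : x - y * Complex.I ≠ b := fun e => hx (by rw [← e]; ring)
    have h0 : x - y * Complex.I - b ≠ 0 := sub_ne_zero.2 hx'
    have h1 : x - (b + y * Complex.I) = x - y * Complex.I - b := by ring
    simp only [hGdef, conformalKernel, dslope_of_ne _ hx', slope_def_field, h1]
    rw [div_div]
    congr 1
    field_simp
  have hkey := integral_lower_side_div_sub hS hG (ρ := 2 * r) (δ := 2 * r)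
    (β := b + y * Complex.I) (by simp [abs_lt]; constructor <;> linarith) (by simp; linarith)
    (by simp; linarith) (fun x hx => by
      obtain ⟨⟨h1, h2⟩, h3, h4⟩ := Complex.mem_reProdIm.1 hx
      refine ⟨Complex.mem_ball_zero_of_abs_le (A := 2 * r) (B := 3 * r) ?_ ?_ (by linarith),
        Complex.mem_ball_zero_of_abs_le (A := 2 * r) (B := 3 * r) ?_ ?_ (by linarith), ?_⟩
      · simp [abs_le]; constructor <;> linarith
      · simp [abs_le]; constructor <;> linarith
      · simp [abs_le]; constructor <;> linarith
      · simp [abs_le]; constructor <;> linarith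
      · intro e
        have := congrArg Complex.im e
        simp at this
        linarith)
  have hGβ : G (b + y * Complex.I) =
      deriv φ (b + 2 * y * Complex.I) / (φ (b + 2 * y * Complex.I) - φ a) := by
    have e1 : b + y * Complex.I + y * Complex.I = b + 2 * y * Complex.I := by ring
    have e2 : b + y * Complex.I - y * Complex.I = b := by ring
    simp only [hGdef, e1, e2, dslope_same]
    exact mul_div_mul_right _ _ (hψ.deriv_ne_zero b hbR)
  have g1 : ∀ x : ℝ, G x / ((x : ℂ) - (b + y * Complex.I)) =
      conformalKernel φ ψ (φ a) (ψ b) (x + y * Complex.I) (x - y * Complex.I) := fun x =>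
    hGk _ fun e => by
      have := congrArg Complex.im e
      simp at this
      linarith
  have g2 : ∀ x : ℝ, G (x + (2 * r : ℝ) * Complex.I) /
      ((x : ℂ) + (2 * r : ℝ) * Complex.I - (b + y * Complex.I)) = _ := fun x =>
    hGk _ fun e => by
      have := congrArg Complex.im e
      simp at this
      linarith
  have g3 : ∀ t : ℝ, G ((2 * r : ℝ) + t * Complex.I) /
      (((2 * r : ℝ) : ℂ) + t * Complex.I - (b + y * Complex.I)) = _ := fun x =>
    hGk _ fun e => by
      have := congrArg Complex.re e
      simp at this
      linarith
  have g4 : ∀ t : ℝ, G (-((2 * r : ℝ) : ℂ) + t * Complex.I) /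
      (-((2 * r : ℝ) : ℂ) + t * Complex.I - (b + y * Complex.I)) = _ := fun x =>
    hGk _ fun e => by
      have := congrArg Complex.re e
      simp at this
      linarith
  simp only [g1, g2, g3, g4, hGβ] at hkey
  exact hkey

/-! ### Sweep integrals -/

/-- The kernel integrated over the parameters `y ∈ [0, r]`, `t ∈ [c, d]`, where the curve `e` is
swept upwards in the holomorphic variable and downwards in the antiholomorphic one. -/
noncomputable def sweepIntegral (φ ψ : ℂ → ℂ) (e : ℝ → ℂ) (c d r : ℝ) (z v : ℂ) : ℂ :=
  ∫ k in Icc (0 : ℝ) r ×ˢ Icc c d,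
    conformalKernel φ ψ z v (e k.2 + k.1 * Complex.I) (e k.2 - k.1 * Complex.I)

theorem integrable_of_continuousOn_Icc_prod {f : ℝ × ℝ → ℂ} {r c d : ℝ}
    (hf : ContinuousOn f (Icc 0 r ×ˢ Icc c d)) :
    Integrable f ((volume.restrict (Icc 0 r)).prod (volume.restrict (Icc c d))) := by
  rw [Measure.prod_restrict]
  exact hf.integrableOn_compact (isCompact_Icc.prod isCompact_Icc)

theorem setIntegral_Icc_prod_eq_intervalIntegral {f : ℝ × ℝ → ℂ} {r c d : ℝ} (hr : 0 ≤ r)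
    (hcd : c ≤ d) (hf : ContinuousOn f (Icc 0 r ×ˢ Icc c d)) :
    ∫ k in Icc (0 : ℝ) r ×ˢ Icc c d, f k = ∫ y in (0 : ℝ)..r, ∫ t in c..d, f (y, t) := by
  rw [Measure.volume_eq_prod, ← Measure.prod_restrict,
    integral_prod _ (integrable_of_continuousOn_Icc_prod hf),
    intervalIntegral.integral_of_le hr, ← integral_Icc_eq_integral_Ioc]
  simp only [intervalIntegral.integral_of_le hcd, ← integral_Icc_eq_integral_Ioc]

theorem intervalIntegrable_intervalIntegral {f : ℝ × ℝ → ℂ} {r c d : ℝ} (hr : 0 ≤ r)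
    (hcd : c ≤ d) (hf : ContinuousOn f (Icc 0 r ×ˢ Icc c d)) :
    IntervalIntegrable (fun y => ∫ t in c..d, f (y, t)) volume 0 r := by
  rw [intervalIntegrable_iff_integrableOn_Icc_of_le hr]
  simp only [intervalIntegral.integral_of_le hcd, ← integral_Icc_eq_integral_Ioc]
  exact (integrable_of_continuousOn_Icc_prod hf).integral_prod_left

/-- The sweep of `e` stays inside the disc of radius `R` and off the poles of the kernel. -/
structure SweepAdmissible (φ ψ : ℂ → ℂ) (R : ℝ) (e : ℝ → ℂ) (c d r : ℝ) (z v : ℂ) : Prop where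
  continuous : Continuous e
  add_mem : ∀ y ∈ Icc 0 r, ∀ t ∈ Icc c d, e t + y * Complex.I ∈ Metric.ball (0 : ℂ) R
  sub_mem : ∀ y ∈ Icc 0 r, ∀ t ∈ Icc c d, e t - y * Complex.I ∈ Metric.ball (0 : ℂ) R
  apply_add_ne : ∀ y ∈ Icc 0 r, ∀ t ∈ Icc c d, φ (e t + y * Complex.I) ≠ z
  apply_sub_ne : ∀ y ∈ Icc 0 r, ∀ t ∈ Icc c d, ψ (e t - y * Complex.I) ≠ v

namespace SweepAdmissible

variable {φ ψ f : ℂ → ℂ} {R r c d : ℝ} {e : ℝ → ℂ} {z v : ℂ}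

theorem continuousOn_comp_add (h : SweepAdmissible φ ψ R e c d r z v)
    (hf : DifferentiableOn ℂ f (Metric.ball 0 R)) :
    ContinuousOn (fun k : ℝ × ℝ => f (e k.2 + k.1 * Complex.I)) (Icc 0 r ×ˢ Icc c d) := by
  have he := h.continuous
  exact hf.continuousOn.comp (by fun_prop) fun k hk => h.add_mem _ hk.1 _ hk.2

theorem continuousOn_comp_sub (h : SweepAdmissible φ ψ R e c d r z v)
    (hf : DifferentiableOn ℂ f (Metric.ball 0 R)) :
    ContinuousOn (fun k : ℝ × ℝ => f (e k.2 - k.1 * Complex.I)) (Icc 0 r ×ˢ Icc c d) := by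
  have he := h.continuous
  exact hf.continuousOn.comp (by fun_prop) fun k hk => h.sub_mem _ hk.1 _ hk.2

theorem continuousOn_weight (h : SweepAdmissible φ ψ R e c d r z v)
    (hφ : IsConformalOn φ (Metric.ball 0 R)) (hψ : IsConformalOn ψ (Metric.ball 0 R)) :
    ContinuousOn (fun k : ℝ × ℝ => deriv φ (e k.2 + k.1 * Complex.I) *
      deriv ψ (e k.2 - k.1 * Complex.I)) (Icc 0 r ×ˢ Icc c d) :=
  (h.continuousOn_comp_add (hφ.differentiableOn.deriv Metric.isOpen_ball)).mul
    (h.continuousOn_comp_sub (hψ.differentiableOn.deriv Metric.isOpen_ball))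

theorem continuousOn_conformalKernel (h : SweepAdmissible φ ψ R e c d r z v)
    (hφ : IsConformalOn φ (Metric.ball 0 R)) (hψ : IsConformalOn ψ (Metric.ball 0 R)) :
    ContinuousOn (fun k : ℝ × ℝ =>
      conformalKernel φ ψ z v (e k.2 + k.1 * Complex.I) (e k.2 - k.1 * Complex.I))
      (Icc 0 r ×ˢ Icc c d) :=
  (h.continuousOn_weight hφ hψ).div
    (((h.continuousOn_comp_add hφ.differentiableOn).sub continuousOn_const).mul
      ((h.continuousOn_comp_sub hψ.differentiableOn).sub continuousOn_const))
    fun _ hk => mul_ne_zero (sub_ne_zero.2 (h.apply_add_ne _ hk.1 _ hk.2))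
      (sub_ne_zero.2 (h.apply_sub_ne _ hk.1 _ hk.2))

theorem analyticAt_sweepIntegral (h : SweepAdmissible φ ψ R e c d r z v)
    (hφ : IsConformalOn φ (Metric.ball 0 R)) (hψ : IsConformalOn ψ (Metric.ball 0 R)) :
    AnalyticAt ℂ (fun w : ℂ × ℂ => sweepIntegral φ ψ e c d r w.1 w.2) (z, v) := by
  have hK : IsCompact (Icc (0 : ℝ) r ×ˢ Icc c d) := isCompact_Icc.prod isCompact_Icc
  refine analyticAt_integral_div_sub_mul_sub (μ := volume) hK
    (measurableSet_Icc.prod measurableSet_Icc) hK.measure_lt_top.ne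
    (h.continuousOn_comp_add hφ.differentiableOn) (h.continuousOn_comp_sub hψ.differentiableOn)
    (h.continuousOn_weight hφ hψ) ?_ ?_
  · rintro ⟨k, hk, hk'⟩
    exact h.apply_add_ne _ hk.1 _ hk.2 hk'
  · rintro ⟨k, hk, hk'⟩
    exact h.apply_sub_ne _ hk.1 _ hk.2 hk'

theorem sweepIntegral_eq (h : SweepAdmissible φ ψ R e c d r z v)
    (hφ : IsConformalOn φ (Metric.ball 0 R)) (hψ : IsConformalOn ψ (Metric.ball 0 R))
    (hr : 0 ≤ r) (hcd : c ≤ d) :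
    sweepIntegral φ ψ e c d r z v = ∫ y in (0 : ℝ)..r, ∫ t in c..d,
      conformalKernel φ ψ z v (e t + y * Complex.I) (e t - y * Complex.I) :=
  setIntegral_Icc_prod_eq_intervalIntegral hr hcd (h.continuousOn_conformalKernel hφ hψ)

theorem intervalIntegrable (h : SweepAdmissible φ ψ R e c d r z v)
    (hφ : IsConformalOn φ (Metric.ball 0 R)) (hψ : IsConformalOn ψ (Metric.ball 0 R))
    (hr : 0 ≤ r) (hcd : c ≤ d) :
    IntervalIntegrable (fun y : ℝ => ∫ t in c..d,
      conformalKernel φ ψ z v (e t + y * Complex.I) (e t - y * Complex.I)) volume 0 r :=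
  intervalIntegrable_intervalIntegral hr hcd (h.continuousOn_conformalKernel hφ hψ)

end SweepAdmissible

/-! ### Replacing the base by the three other sides -/

/-- The sum of the sweep integrals over the left, upper and right sides of a square. -/
noncomputable def archIntegral (φ ψ : ℂ → ℂ) (r : ℝ) (z v : ℂ) : ℂ :=
  sweepIntegral φ ψ (fun x => x + (2 * r : ℝ) * Complex.I) (-(2 * r)) (2 * r) r z v -
    Complex.I * sweepIntegral φ ψ (fun t => (2 * r : ℝ) + t * Complex.I) 0 (2 * r) r z v +
    Complex.I * sweepIntegral φ ψ (fun t => -(2 * r : ℝ) + t * Complex.I) 0 (2 * r) r z v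

section Arch

variable {φ ψ : ℂ → ℂ} {r R : ℝ} {a b : ℂ}

/-- By injectivity it suffices to keep `e t + iy` off `a` and `e t - iy` off `b`. On the lateral
sides the real part has modulus `2r > r`. On the top the imaginary part stays at least `r`. Only the
base needs the signs of `Im a` and `Im b`. All swept points have norm at most `2r + 3r < R`. -/
theorem IsConformalOn.sweepAdmissible (hφ : IsConformalOn φ (Metric.ball 0 R))
    (hψ : IsConformalOn ψ (Metric.ball 0 R)) (hr : 0 < r) (hR : 10 * r ≤ R)
    (ha : a ∈ Metric.ball 0 r) (hb : b ∈ Metric.ball 0 r) {e : ℝ → ℂ} (he : Continuous e)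
    {c d : ℝ} (hre : ∀ t ∈ Icc c d, |(e t).re| ≤ 2 * r)
    (him : ∀ t ∈ Icc c d, (e t).im ∈ Icc 0 (2 * r))
    (h : ∀ t ∈ Icc c d, |(e t).re| = 2 * r ∨ (e t).im = 2 * r ∨ a.im < 0 ∧ 0 < b.im ∧
      (e t).im = 0) :
    SweepAdmissible φ ψ R e c d r (φ a) (ψ b) := by
  have hrR : Metric.ball (0 : ℂ) r ⊆ Metric.ball 0 R := Metric.ball_subset_ball (by linarith)
  have hmem : ∀ y ∈ Icc 0 r, ∀ t ∈ Icc c d, e t + y * Complex.I ∈ Metric.ball (0 : ℂ) R ∧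
      e t - y * Complex.I ∈ Metric.ball (0 : ℂ) R := by
    intro y hy t ht
    obtain ⟨h0, h1⟩ := hy
    obtain ⟨h2, h3⟩ := him t ht
    have h4 := hre t ht
    constructor <;> refine Complex.mem_ball_zero_of_abs_le (A := 2 * r) (B := 3 * r)
      (by simpa using h4) ?_ (by linarith) <;> simp [abs_le] <;> constructor <;> linarith
  have ha' := mem_ball_zero_iff.1 (ha)
  have hb' := mem_ball_zero_iff.1 (hb)
  have har := (Complex.abs_re_le_norm a).trans_lt ha'
  have hai := abs_lt.1 ((Complex.abs_im_le_norm a).trans_lt ha')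
  have hbr := (Complex.abs_re_le_norm b).trans_lt hb'
  have hbi := abs_lt.1 ((Complex.abs_im_le_norm b).trans_lt hb')
  refine ⟨he, fun y hy t ht => (hmem y hy t ht).1, fun y hy t ht => (hmem y hy t ht).2,
    fun y hy t ht heq => ?_, fun y hy t ht heq => ?_⟩
  · have e1 := hφ.injOn (hmem y hy t ht).1 (hrR ha) heq
    obtain ⟨h0, h1⟩ := hy
    rcases h t ht with h' | h' | ⟨h', _, h''⟩ <;> simp [← e1] at har hai h' <;> linarith
  · have e1 := hψ.injOn (hmem y hy t ht).2 (hrR hb) heq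
    obtain ⟨h0, h1⟩ := hy
    rcases h t ht with h' | h' | ⟨_, h', h''⟩ <;> simp [← e1] at hbr hbi h' <;> linarith

theorem IsConformalOn.sweepAdmissible_top (hφ : IsConformalOn φ (Metric.ball 0 R))
    (hψ : IsConformalOn ψ (Metric.ball 0 R)) (hr : 0 < r) (hR : 10 * r ≤ R)
    (ha : a ∈ Metric.ball 0 r) (hb : b ∈ Metric.ball 0 r) :
    SweepAdmissible φ ψ R (fun x => x + (2 * r : ℝ) * Complex.I) (-(2 * r)) (2 * r) r
      (φ a) (ψ b) :=
  hφ.sweepAdmissible hψ hr hR ha hb (by fun_prop) (fun t ht => by simpa [abs_le] using ht)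
    (fun t _ => by simp; linarith) (fun t _ => by simp)

theorem IsConformalOn.sweepAdmissible_right (hφ : IsConformalOn φ (Metric.ball 0 R))
    (hψ : IsConformalOn ψ (Metric.ball 0 R)) (hr : 0 < r) (hR : 10 * r ≤ R)
    (ha : a ∈ Metric.ball 0 r) (hb : b ∈ Metric.ball 0 r) :
    SweepAdmissible φ ψ R (fun t => (2 * r : ℝ) + t * Complex.I) 0 (2 * r) r (φ a) (ψ b) :=
  hφ.sweepAdmissible hψ hr hR ha hb (by fun_prop) (fun t _ => by simp [abs_of_pos hr])
    (fun t ht => by simpa using ht) (fun t _ => by simp [abs_of_pos hr])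

theorem IsConformalOn.sweepAdmissible_left (hφ : IsConformalOn φ (Metric.ball 0 R))
    (hψ : IsConformalOn ψ (Metric.ball 0 R)) (hr : 0 < r) (hR : 10 * r ≤ R)
    (ha : a ∈ Metric.ball 0 r) (hb : b ∈ Metric.ball 0 r) :
    SweepAdmissible φ ψ R (fun t => -(2 * r : ℝ) + t * Complex.I) 0 (2 * r) r (φ a) (ψ b) :=
  hφ.sweepAdmissible hψ hr hR ha hb (by fun_prop) (fun t _ => by simp [abs_of_pos hr])
    (fun t ht => by simpa using ht) (fun t _ => by simp [abs_of_pos hr])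

theorem IsConformalOn.sweepAdmissible_base (hφ : IsConformalOn φ (Metric.ball 0 R))
    (hψ : IsConformalOn ψ (Metric.ball 0 R)) (hr : 0 < r) (hR : 10 * r ≤ R)
    (ha : a ∈ Metric.ball 0 r) (hb : b ∈ Metric.ball 0 r) (ha' : a.im < 0) (hb' : 0 < b.im) :
    SweepAdmissible φ ψ R (fun x => (x : ℂ)) (-(2 * r)) (2 * r) r (φ a) (ψ b) :=
  hφ.sweepAdmissible hψ hr hR ha hb (by fun_prop) (fun t ht => by simpa [abs_le] using ht)
    (fun t _ => by simp; linarith) (fun t _ => by simp [ha', hb'])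

/-- No sign condition on `a` or `b` enters, so this term continues analytically across the arc. -/
theorem IsConformalOn.analyticAt_archIntegral (hφ : IsConformalOn φ (Metric.ball 0 R))
    (hψ : IsConformalOn ψ (Metric.ball 0 R)) (hr : 0 < r) (hR : 10 * r ≤ R)
    (ha : a ∈ Metric.ball 0 r) (hb : b ∈ Metric.ball 0 r) :
    AnalyticAt ℂ (fun w : ℂ × ℂ => archIntegral φ ψ r w.1 w.2) (φ a, ψ b) :=
  (((hφ.sweepAdmissible_top hψ hr hR ha hb).analyticAt_sweepIntegral hφ hψ).sub
    (analyticAt_const.mul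
      ((hφ.sweepAdmissible_right hψ hr hR ha hb).analyticAt_sweepIntegral hφ hψ))).add
    (analyticAt_const.mul
      ((hφ.sweepAdmissible_left hψ hr hR ha hb).analyticAt_sweepIntegral hφ hψ))

theorem IsConformalOn.vertical_mem_ball (hr : 0 < r) (hR : 10 * r ≤ R)
    (hb : b ∈ Metric.ball 0 r) {y : ℝ} (hy : y ∈ Icc 0 r) :
    b + 2 * y * Complex.I ∈ Metric.ball (0 : ℂ) R := by
  have hb' := mem_ball_zero_iff.1 hb
  have hbr := (Complex.abs_re_le_norm b).trans_lt hb'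
  have hbi := abs_lt.1 ((Complex.abs_im_le_norm b).trans_lt hb')
  obtain ⟨h0, h1⟩ := hy
  refine Complex.mem_ball_zero_of_abs_le (A := r) (B := 3 * r) (by simpa using hbr.le) ?_
    (by linarith)
  simp [abs_le]
  constructor <;> linarith

theorem IsConformalOn.apply_vertical_sub_ne_zero (hφ : IsConformalOn φ (Metric.ball 0 R))
    (hr : 0 < r) (hR : 10 * r ≤ R) (ha : a ∈ Metric.ball 0 r) (hb : b ∈ Metric.ball 0 r)
    (ha' : a.im < 0) (hb' : 0 < b.im) {y : ℝ} (hy : y ∈ Icc 0 r) :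
    φ (b + 2 * y * Complex.I) - φ a ≠ 0 := by
  have hrR : Metric.ball (0 : ℂ) r ⊆ Metric.ball 0 R := Metric.ball_subset_ball (by linarith)
  refine sub_ne_zero.2 fun e => ?_
  have := congrArg Complex.im
    (hφ.injOn (IsConformalOn.vertical_mem_ball hr hR hb hy) (hrR ha) e)
  simp at this
  linarith [hy.1]

theorem IsConformalOn.continuousOn_deriv_vertical (hφ : IsConformalOn φ (Metric.ball 0 R))
    (hr : 0 < r) (hR : 10 * r ≤ R) (hb : b ∈ Metric.ball 0 r) :
    ContinuousOn (fun y : ℝ => deriv φ (b + 2 * y * Complex.I)) (Icc 0 r) :=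
  (hφ.differentiableOn.deriv Metric.isOpen_ball).continuousOn.comp (by fun_prop)
    fun _ hy => IsConformalOn.vertical_mem_ball hr hR hb hy

theorem IsConformalOn.continuousOn_vertical (hφ : IsConformalOn φ (Metric.ball 0 R))
    (hr : 0 < r) (hR : 10 * r ≤ R) (hb : b ∈ Metric.ball 0 r) :
    ContinuousOn (fun y : ℝ => φ (b + 2 * y * Complex.I)) (Icc 0 r) :=
  hφ.differentiableOn.continuousOn.comp (by fun_prop)
    fun _ hy => IsConformalOn.vertical_mem_ball hr hR hb hy

theorem IsConformalOn.sweepIntegral_base (hφ : IsConformalOn φ (Metric.ball 0 R))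
    (hψ : IsConformalOn ψ (Metric.ball 0 R)) (hr : 0 < r) (hR : 10 * r ≤ R)
    (ha : a ∈ Metric.ball 0 r) (hb : b ∈ Metric.ball 0 r) (ha' : a.im < 0) (hb' : 0 < b.im) :
    sweepIntegral φ ψ (fun x => (x : ℂ)) (-(2 * r)) (2 * r) r (φ a) (ψ b) =
      archIntegral φ ψ r (φ a) (ψ b) + 2 * Real.pi * Complex.I * ∫ y in (0 : ℝ)..r,
        deriv φ (b + 2 * y * Complex.I) / (φ (b + 2 * y * Complex.I) - φ a) := by
  have h1 : -(2 * r) ≤ 2 * r := by linarith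
  have h2 : 0 ≤ 2 * r := by linarith
  have T := hφ.sweepAdmissible_top hψ hr hR ha hb
  have Rt := hφ.sweepAdmissible_right hψ hr hR ha hb
  have Lt := hφ.sweepAdmissible_left hψ hr hR ha hb
  have Bs := hφ.sweepAdmissible_base hψ hr hR ha hb ha' hb'
  have iT := T.intervalIntegrable hφ hψ hr.le h1
  have iR := (Rt.intervalIntegrable hφ hψ hr.le h2).const_mul Complex.I
  have iL := (Lt.intervalIntegrable hφ hψ hr.le h2).const_mul Complex.I
  have iV : IntervalIntegrable (fun y : ℝ => 2 * Real.pi * Complex.I *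
      (deriv φ (b + 2 * y * Complex.I) / (φ (b + 2 * y * Complex.I) - φ a))) volume 0 r := by
    refine ContinuousOn.intervalIntegrable ?_
    rw [uIcc_of_le hr.le]
    exact continuousOn_const.mul ((hφ.continuousOn_deriv_vertical hr hR hb).div
      ((hφ.continuousOn_vertical hr hR hb).sub continuousOn_const)
      fun y hy => hφ.apply_vertical_sub_ne_zero hr hR ha hb ha' hb' hy)
  rw [archIntegral, Bs.sweepIntegral_eq hφ hψ hr.le h1, T.sweepIntegral_eq hφ hψ hr.le h1,
    Rt.sweepIntegral_eq hφ hψ hr.le h2, Lt.sweepIntegral_eq hφ hψ hr.le h2,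
    ← intervalIntegral.integral_const_mul, ← intervalIntegral.integral_const_mul,
    ← intervalIntegral.integral_const_mul, ← intervalIntegral.integral_sub iT iR,
    ← intervalIntegral.integral_add (iT.sub iR) iL,
    ← intervalIntegral.integral_add ((iT.sub iR).add iL) iV]
  refine intervalIntegral.integral_congr fun y hy => ?_
  rw [uIcc_of_le hr.le] at hy
  exact integral_conformalKernel_shift hφ hψ hR ha hb ha' hb' hy

/-- The factor `-1/π` turns `2πi` into `-2i`, and `2i` is the velocity of `y ↦ b + 2iy`. The residue
term is therefore exactly minus the integral of a logarithmic derivative, with coefficient one. This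
makes the zero simple. -/
theorem IsConformalOn.exp_sweepIntegral_base (hφ : IsConformalOn φ (Metric.ball 0 R))
    (hψ : IsConformalOn ψ (Metric.ball 0 R)) (hr : 0 < r) (hR : 10 * r ≤ R)
    (ha : a ∈ Metric.ball 0 r) (hb : b ∈ Metric.ball 0 r) (ha' : a.im < 0) (hb' : 0 < b.im) :
    Complex.exp (-(1 / (Real.pi : ℂ)) *
        sweepIntegral φ ψ (fun x => (x : ℂ)) (-(2 * r)) (2 * r) r (φ a) (ψ b)) =
      Complex.exp (-(1 / (Real.pi : ℂ)) * archIntegral φ ψ r (φ a) (ψ b)) *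
        ((φ b - φ a) / (φ (b + 2 * r * Complex.I) - φ a)) := by
  have hπ : (Real.pi : ℂ) ≠ 0 := by exact_mod_cast Real.pi_ne_zero
  have hE := exp_neg_integral_logDeriv (q := fun y : ℝ => φ (b + 2 * y * Complex.I) - φ a)
    (q' := fun y : ℝ => deriv φ (b + 2 * y * Complex.I) * (2 * Complex.I)) hr.le
    (fun y hy => by
      have h1 : HasDerivAt (fun y : ℝ => b + 2 * y * Complex.I) (2 * Complex.I) y := by
        simpa using (((Complex.ofRealCLM.hasDerivAt (x := y)).const_mul 2).mul_const
          Complex.I).const_add b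
      have h2 := (hφ.differentiableOn.differentiableAt (Metric.isOpen_ball.mem_nhds
        (IsConformalOn.vertical_mem_ball hr hR hb hy))).hasDerivAt
      exact (h2.comp y h1).sub_const _)
    ((hφ.continuousOn_deriv_vertical hr hR hb).mul continuousOn_const)
    (fun y hy => hφ.apply_vertical_sub_ne_zero hr hR ha hb ha' hb' hy)
  simp only [Complex.ofReal_zero, mul_zero, zero_mul, add_zero] at hE
  rw [← hE, ← Complex.exp_add, hφ.sweepIntegral_base hψ hr hR ha hb ha' hb']
  congr 1
  have : ∀ y : ℝ, deriv φ (b + 2 * y * Complex.I) * (2 * Complex.I) /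
      (φ (b + 2 * y * Complex.I) - φ a) = 2 * Complex.I *
      (deriv φ (b + 2 * y * Complex.I) / (φ (b + 2 * y * Complex.I) - φ a)) := fun y => by ring
  simp only [this, intervalIntegral.integral_const_mul]
  field_simp
  ring

end Arch

/-! ### Inverse of a conformal map -/

section Inverse

variable {φ : ℂ → ℂ} {B : Set ℂ}

theorem IsConformalOn.mono {A : Set ℂ} (hφ : IsConformalOn φ B) (h : A ⊆ B) :
    IsConformalOn φ A :=
  ⟨hφ.differentiableOn.mono h, hφ.injOn.mono h, fun s hs => hφ.deriv_ne_zero s (h hs)⟩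

theorem IsConformalOn.hasStrictDerivAt (hφ : IsConformalOn φ B) (hB : IsOpen B) {s : ℂ}
    (hs : s ∈ B) : HasStrictDerivAt φ (deriv φ s) s :=
  (hφ.differentiableOn.analyticAt (hB.mem_nhds hs)).hasStrictDerivAt

theorem IsConformalOn.isOpen_image (hφ : IsConformalOn φ B) (hB : IsOpen B) :
    IsOpen (φ '' B) := by
  refine isOpen_iff_mem_nhds.2 ?_
  rintro _ ⟨s, hs, rfl⟩
  rw [← (hφ.hasStrictDerivAt hB hs).map_nhds_eq (hφ.deriv_ne_zero s hs)]
  exact Filter.image_mem_map (hB.mem_nhds hs)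

theorem IsConformalOn.invFunOn_apply (hφ : IsConformalOn φ B) {s : ℂ} (hs : s ∈ B) :
    Function.invFunOn φ B (φ s) = s :=
  hφ.injOn.leftInvOn_invFunOn hs

/-- Near `φ s` the local inverse takes values in `B`, where injectivity forces it to agree with the
global one. -/
theorem IsConformalOn.differentiableOn_invFunOn (hφ : IsConformalOn φ B) (hB : IsOpen B) :
    DifferentiableOn ℂ (Function.invFunOn φ B) (φ '' B) := by
  rintro _ ⟨s, hs, rfl⟩
  have hd := hφ.hasStrictDerivAt hB hs
  have h0 := hφ.deriv_ne_zero s hs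
  refine DifferentiableAt.differentiableWithinAt ?_
  have hloc := (hd.to_localInverse h0).hasDerivAt.differentiableAt
  refine hloc.congr_of_eventuallyEq ?_
  have hr : ∀ᶠ y in 𝓝 (φ s), φ (hd.localInverse φ (deriv φ s) s h0 y) = y :=
    hd.hasStrictFDerivAt_equiv h0 |>.eventually_right_inverse
  have hm : ∀ᶠ y in 𝓝 (φ s), hd.localInverse φ (deriv φ s) s h0 y ∈ B := by
    refine hloc.continuousAt.eventually ?_
    rw [show hd.localInverse φ (deriv φ s) s h0 (φ s) = s from
      (hd.hasStrictFDerivAt_equiv h0).localInverse_apply_image]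
    exact hB.mem_nhds hs
  filter_upwards [hr, hm] with y h1 h2
  conv_lhs => rw [← h1]
  exact hφ.invFunOn_apply h2

end Inverse

/-! ### The area integral in conformal coordinates, and uniqueness -/

/-- The conjugate of `φ` by complex conjugation. -/
noncomputable def conjConj (φ : ℂ → ℂ) : ℂ → ℂ := conj ∘ φ ∘ conj

theorem conjConj_apply (φ : ℂ → ℂ) (u : ℂ) : conjConj φ u = conj (φ (conj u)) := rfl

theorem deriv_conjConj (φ : ℂ → ℂ) (u : ℂ) : deriv (conjConj φ) u = conj (deriv φ (conj u)) :=
  congrFun deriv_conj_conj u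

theorem conj_mem_ball_zero {u : ℂ} {R : ℝ} :
    conj u ∈ Metric.ball (0 : ℂ) R ↔ u ∈ Metric.ball (0 : ℂ) R := by
  simp

theorem IsConformalOn.conjConj {φ : ℂ → ℂ} {R : ℝ} (hφ : IsConformalOn φ (Metric.ball 0 R)) :
    IsConformalOn (conjConj φ) (Metric.ball 0 R) where
  differentiableOn := fun u hu => by
    have h := (hφ.differentiableOn.differentiableAt
      (Metric.isOpen_ball.mem_nhds (conj_mem_ball_zero.2 hu))).conj_conj
    rw [Complex.conj_conj] at h
    exact h.differentiableWithinAt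
  injOn := fun u hu w hw h => by
    have h1 := hφ.injOn (conj_mem_ball_zero.2 hu) (conj_mem_ball_zero.2 hw)
      ((starRingEnd ℂ).injective h)
    exact (starRingEnd ℂ).injective h1
  deriv_ne_zero := fun u hu => by
    rw [deriv_conjConj]
    exact (map_ne_zero _).2 (hφ.deriv_ne_zero _ (conj_mem_ball_zero.2 hu))

/-- The area integral over a conformal half square, in conformal coordinates. -/
theorem IsConformalOn.integral_image_rect {φ : ℂ → ℂ} {R r c d : ℝ}
    (hφ : IsConformalOn φ (Metric.ball 0 R))
    (hsub : Ioo c d ×ℂ Ioo 0 r ⊆ Metric.ball 0 R) (z v : ℂ) :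
    ∫ ζ in φ '' (Ioo c d ×ℂ Ioo 0 r), 1 / ((ζ - z) * (conj ζ - v)) =
      sweepIntegral φ (_root_.conjConj φ) (fun x => (x : ℂ)) c d r z v := by
  have hm : MeasurableSet (Ioo c d ×ℂ Ioo 0 r) := (isOpen_Ioo.reProdIm isOpen_Ioo).measurableSet
  have hdet : ∀ w : ℂ, ((ContinuousLinearMap.toSpanSingleton ℂ w).restrictScalars ℝ).det =
      Complex.normSq w := by
    intro w
    have : ((ContinuousLinearMap.toSpanSingleton ℂ w).restrictScalars ℝ).det =
      LinearMap.det (((LinearMap.toSpanSingleton ℂ ℂ w)).restrictScalars ℝ) := rfl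
    rw [this, LinearMap.det_restrictScalars, Algebra.norm_complex_apply]
    simp
  rw [integral_image_eq_integral_abs_det_fderiv_smul volume hm
    (f' := fun s => (ContinuousLinearMap.toSpanSingleton ℂ (deriv φ s)).restrictScalars ℝ)
    (fun s hs => ((hφ.differentiableOn.differentiableAt
      (Metric.isOpen_ball.mem_nhds (hsub hs))).hasDerivAt.hasFDerivAt.restrictScalars
        ℝ).hasFDerivWithinAt) (hφ.injOn.mono hsub)]
  -- The Jacobian `|φ'(s)|²` factors as `φ'(s) ψ'(conj s)` with `ψ = conjConj φ`, which lets `s` and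
  -- `conj s` become independent variables.
  have h1 : ∀ s : ℂ, |((ContinuousLinearMap.toSpanSingleton ℂ (deriv φ s)).restrictScalars ℝ).det|
      • (1 / ((φ s - z) * (conj (φ s) - v))) =
      conformalKernel φ (_root_.conjConj φ) z v s (conj s) := by
    intro s
    rw [hdet, abs_of_nonneg (Complex.normSq_nonneg _), conformalKernel, deriv_conjConj,
      conjConj_apply, Complex.conj_conj, Complex.mul_conj, Complex.real_smul, mul_one_div]
  simp only [h1]
  rw [← Complex.volume_preserving_equiv_real_prod.symm.setIntegral_preimage_emb
    (MeasurableEquiv.measurableEmbedding _)]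
  have hpre : Complex.measurableEquivRealProd.symm ⁻¹' (Ioo c d ×ℂ Ioo 0 r) =
      Ioo c d ×ˢ Ioo 0 r := by
    ext p
    simp [Complex.mem_reProdIm]
  rw [hpre, sweepIntegral, Measure.volume_eq_prod, ← setIntegral_prod_swap]
  rw [setIntegral_congr_set (Measure.set_prod_ae_eq Ioo_ae_eq_Icc Ioo_ae_eq_Icc)]
  refine setIntegral_congr_fun (measurableSet_Icc.prod measurableSet_Icc) fun k _ => ?_
  have e1 : (⟨k.2, k.1⟩ : ℂ) = k.2 + k.1 * Complex.I := Complex.mk_eq_add_mul_I _ _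
  simp only [Prod.swap, Complex.measurableEquivRealProd_symm_apply, e1]
  simp [sub_eq_add_neg]

theorem continuousOn_cauchyKernel {K : Set ℂ} {z w : ℂ} (hz : z ∉ K) (hw : w ∉ K) :
    ContinuousOn (fun ζ : ℂ => 1 / ((ζ - z) * (conj ζ - conj w))) K := by
  refine continuousOn_const.div ?_ fun ζ hζ => mul_ne_zero ?_ ?_
  · have : Continuous (conj : ℂ → ℂ) := Complex.continuous_conj
    fun_prop
  · exact sub_ne_zero.2 fun e => hz (e ▸ hζ)
  · exact sub_ne_zero.2 fun e => hw ((starRingEnd ℂ).injective e ▸ hζ)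

/-- The part of the area integral over `Ω` that lies in `K`. -/
noncomputable def partIntegral (Ω K : Set ℂ) (z v : ℂ) : ℂ :=
  ∫ ζ in K, 1 / ((ζ - z) * (conj ζ - v)) ∂(volume.restrict Ω)

theorem analyticAt_partIntegral {Ω K : Set ℂ} (hK : IsCompact K) {z w : ℂ} (hz : z ∉ K)
    (hw : w ∉ K) :
    AnalyticAt ℂ (fun p : ℂ × ℂ => partIntegral Ω K p.1 p.2) (z, conj w) := by
  refine analyticAt_integral_div_sub_mul_sub (p := fun ζ => ζ) (q := fun ζ => conj ζ)
    (g := fun _ => 1) hK hK.measurableSet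
    ((Measure.restrict_apply_le _ _).trans_lt hK.measure_lt_top).ne continuousOn_id
    Complex.continuous_conj.continuousOn continuousOn_const (by simpa using hz) ?_
  rintro ⟨ζ, hζ, e⟩
  exact hw ((starRingEnd ℂ).injective e ▸ hζ)

/-- An analytic extension is determined on `U` as soon as there is something to extend. -/
theorem IsAnalyticExtension.eq_of_nonempty {Ω U : Set ℂ} {F G : ℂ → ℂ → ℂ} (hU : IsOpen U)
    (hUc : IsConnected U) (hF : IsAnalyticExtension Ω U F) (hG : IsAnalyticExtension Ω U G)
    (hne : (U \ closure Ω).Nonempty) {z w : ℂ} (hz : z ∈ U) (hw : w ∈ U) :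
    G z (conj w) = F z (conj w) := by
  obtain ⟨c, hc⟩ := hne
  have hset : {p : ℂ × ℂ | p.1 ∈ U ∧ conj p.2 ∈ U} = U ×ˢ (conj '' U) := by
    ext p
    refine and_congr_right fun _ => ⟨fun h => ⟨conj p.2, h, by simp⟩, ?_⟩
    rintro ⟨u, hu, e⟩
    rw [← e, Complex.conj_conj]
    exact hu
  have hpre : IsPreconnected {p : ℂ × ℂ | p.1 ∈ U ∧ conj p.2 ∈ U} := by
    rw [hset]
    exact hUc.isPreconnected.prod
      (hUc.isPreconnected.image _ Complex.continuous_conj.continuousOn)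
  have hW : IsOpen (U \ closure Ω) := hU.sdiff isClosed_closure
  -- Exterior points form an open set, so both extensions equal the kernel on a full neighbourhood
  -- in two independent variables. The identity theorem then applies.
  have hev : (fun p : ℂ × ℂ => G p.1 p.2) =ᶠ[𝓝 (c, conj c)] fun p => F p.1 p.2 := by
    have h1 : ∀ᶠ p : ℂ × ℂ in 𝓝 (c, conj c), p.1 ∈ U \ closure Ω :=
      (continuousAt_fst (p := (c, conj c))).eventually (hW.mem_nhds hc)
    have h2 : ∀ᶠ p : ℂ × ℂ in 𝓝 (c, conj c), conj p.2 ∈ U \ closure Ω := by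
      refine (Complex.continuous_conj.continuousAt.comp
        (continuousAt_snd (p := (c, conj c)))).eventually (hW.mem_nhds ?_)
      simpa using hc
    filter_upwards [h1, h2] with p h1 h2
    have e1 := hG.eq_kernel _ h1 _ h2
    have e2 := hF.eq_kernel _ h1 _ h2
    rw [Complex.conj_conj] at e1 e2
    rw [e1, e2]
  exact hG.analytic.eqOn_of_preconnected_of_eventuallyEq hF.analytic hpre
    (z₀ := (c, conj c)) ⟨hc.1, by simpa using hc.1⟩ hev
    (show (z, conj w) ∈ {p : ℂ × ℂ | p.1 ∈ U ∧ conj p.2 ∈ U} from ⟨hz, by simpa using hw⟩)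

/-! ### Schwarz reflection -/

/-- The reflection which is complex conjugation in the conformal coordinate `φ` on `B`. -/
noncomputable def conformalReflection (φ : ℂ → ℂ) (B : Set ℂ) (w : ℂ) : ℂ :=
  φ (conj (Function.invFunOn φ B w))

section Reflection

variable {φ : ℂ → ℂ} {R : ℝ}

theorem IsConformalOn.conformalReflection_apply (hφ : IsConformalOn φ (Metric.ball 0 R)) {s : ℂ}
    (hs : s ∈ Metric.ball 0 R) :
    conformalReflection φ (Metric.ball 0 R) (φ s) = φ (conj s) := by
  rw [conformalReflection, hφ.invFunOn_apply hs]

theorem IsConformalOn.isSchwarzReflection (hφ : IsConformalOn φ (Metric.ball 0 R)) {Γ : Set ℂ}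
    (hΓ : ∀ s ∈ Metric.ball 0 R, φ s ∈ Γ → s.im = 0) :
    IsSchwarzReflection Γ (φ '' Metric.ball 0 R) (conformalReflection φ (Metric.ball 0 R)) where
  antianalytic := by
    have hB : IsOpen (Metric.ball (0 : ℂ) R) := Metric.isOpen_ball
    refine DifferentiableOn.analyticOnNhd ?_ (hφ.isOpen_image hB)
    refine hφ.conjConj.differentiableOn.comp (hφ.differentiableOn_invFunOn hB) ?_
    rintro _ ⟨s, hs, rfl⟩
    rwa [hφ.invFunOn_apply hs]
  fixes := by
    rintro _ ⟨⟨s, hs, rfl⟩, h⟩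
    rw [hφ.conformalReflection_apply hs, Complex.conj_eq_iff_im.2 (hΓ s hs h)]

/-- The coordinate of `conj v`, conjugated. -/
noncomputable def conjCoord (φ : ℂ → ℂ) (B : Set ℂ) (v : ℂ) : ℂ :=
  conj (Function.invFunOn φ B (conj v))

theorem IsConformalOn.conjCoord_conj (hφ : IsConformalOn φ (Metric.ball 0 R)) {s : ℂ}
    (hs : s ∈ Metric.ball 0 R) : conjCoord φ (Metric.ball 0 R) (conj (φ s)) = conj s := by
  rw [conjCoord, Complex.conj_conj, hφ.invFunOn_apply hs]

/-- The reflection, antianalytic in `w`, is thus expressed by `φ (conjCoord φ B v)`, analytic in `v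
= conj w`. -/
theorem apply_conjCoord_conj (B : Set ℂ) (w : ℂ) :
    φ (conjCoord φ B (conj w)) = conformalReflection φ B w := by
  rw [conjCoord, Complex.conj_conj, conformalReflection]

theorem IsConformalOn.analyticAt_conjCoord (hφ : IsConformalOn φ (Metric.ball 0 R)) {s : ℂ}
    (hs : s ∈ Metric.ball 0 R) :
    AnalyticAt ℂ (conjCoord φ (Metric.ball 0 R)) (conj (φ s)) := by
  have hB : IsOpen (Metric.ball (0 : ℂ) R) := Metric.isOpen_ball
  have hopen : IsOpen (conj ⁻¹' (φ '' Metric.ball (0 : ℂ) R)) :=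
    (hφ.isOpen_image hB).preimage Complex.continuous_conj
  have hmem : conj (φ s) ∈ conj ⁻¹' (φ '' Metric.ball (0 : ℂ) R) :=
    ⟨s, hs, (Complex.conj_conj _).symm⟩
  refine DifferentiableOn.analyticAt (s := conj ⁻¹' (φ '' Metric.ball (0 : ℂ) R)) ?_
    (hopen.mem_nhds hmem)
  intro v hv
  have h := ((hφ.differentiableOn_invFunOn hB).differentiableAt
    ((hφ.isOpen_image hB).mem_nhds hv)).conj_conj
  rw [Complex.conj_conj] at h
  exact h.differentiableWithinAt

theorem IsConformalOn.analyticAt_apply_conjCoord_add (hφ : IsConformalOn φ (Metric.ball 0 R))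
    {s c z : ℂ} (hs : s ∈ Metric.ball 0 R) (hc : conj s + c ∈ Metric.ball 0 R) :
    AnalyticAt ℂ (fun p : ℂ × ℂ => φ (conjCoord φ (Metric.ball 0 R) p.2 + c))
      (z, conj (φ s)) := by
  have h1 : AnalyticAt ℂ (fun p : ℂ × ℂ => conjCoord φ (Metric.ball 0 R) p.2 + c)
      (z, conj (φ s)) :=
    (AnalyticAt.comp_of_eq (hφ.analyticAt_conjCoord hs) analyticAt_snd rfl).add analyticAt_const
  refine AnalyticAt.comp_of_eq (g := φ)
    (hφ.differentiableOn.analyticAt (Metric.isOpen_ball.mem_nhds hc)) h1 ?_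
  simp only [hφ.conjCoord_conj hs]

end Reflection

/-! ### Factorization near one-sided and two-sided arcs -/

/-- The conclusion about the kernel at a boundary point, on the neighbourhood `U`. -/
def HasReflectionFactorization (Ω U : Set ℂ) : Prop :=
  ∃ F : ℂ → ℂ → ℂ, IsAnalyticExtension Ω U F ∧
    ∃ σ : ℂ → ℂ, IsSchwarzReflection (frontier Ω) U σ ∧
      ∃ f : ℂ → ℂ → ℂ, AnalyticInConj f U ∧
        (∀ z ∈ U, ∀ w ∈ U, f z (conj w) ≠ 0) ∧
        ∀ z ∈ U, ∀ w ∈ U, F z (conj w) = (z - σ w) * f z (conj w)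

/-- The nonvanishing factor in the factorization of the kernel near a one-sided boundary arc. -/
noncomputable def kernelFactor (Ω K : Set ℂ) (φ : ℂ → ℂ) (R r : ℝ) (z v : ℂ) : ℂ :=
  -1 / (φ (conjCoord φ (Metric.ball 0 R) v + 2 * r * Complex.I) - z) *
    Complex.exp (-(1 / (Real.pi : ℂ)) *
      (archIntegral φ (conjConj φ) r z v + partIntegral Ω K z v))

section OneSided

variable {Ω : Set ℂ} {φ : ℂ → ℂ} {R r : ℝ}

/-- The shift by `2ri` lifts the imaginary part above `r`, out of the reach of `a`. -/
theorem IsConformalOn.kernelFactor_denom_ne_zero (hφ : IsConformalOn φ (Metric.ball 0 R))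
    (hr : 0 < r) (hR : 10 * r ≤ R) {a s : ℂ} (ha : a ∈ Metric.ball 0 r)
    (hs : s ∈ Metric.ball 0 r) :
    φ (conj s + 2 * r * Complex.I) - φ a ≠ 0 := by
  have hrR : Metric.ball (0 : ℂ) r ⊆ Metric.ball 0 R := Metric.ball_subset_ball (by linarith)
  refine sub_ne_zero.2 fun e => ?_
  have := congrArg Complex.im (hφ.injOn (IsConformalOn.vertical_mem_ball hr hR
    (conj_mem_ball_zero.2 hs) ⟨hr.le, le_rfl⟩) (hrR ha) e)
  have h1 := abs_lt.1 ((Complex.abs_im_le_norm a).trans_lt (mem_ball_zero_iff.1 ha))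
  have h2 := abs_lt.1 ((Complex.abs_im_le_norm s).trans_lt (mem_ball_zero_iff.1 hs))
  simp at this
  linarith

theorem IsConformalOn.analyticAt_kernelFactor (hφ : IsConformalOn φ (Metric.ball 0 R))
    (hr : 0 < r) (hR : 10 * r ≤ R) {K : Set ℂ} (hK : IsCompact K)
    (hKd : ∀ s ∈ Metric.ball 0 r, φ s ∉ K) {a s : ℂ} (ha : a ∈ Metric.ball 0 r)
    (hs : s ∈ Metric.ball 0 r) :
    AnalyticAt ℂ (fun p : ℂ × ℂ => kernelFactor Ω K φ R r p.1 p.2) (φ a, conj (φ s)) := by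
  have hrR : Metric.ball (0 : ℂ) r ⊆ Metric.ball 0 R := Metric.ball_subset_ball (by linarith)
  have h1 : AnalyticAt ℂ (fun p : ℂ × ℂ =>
      φ (conjCoord φ (Metric.ball 0 R) p.2 + 2 * r * Complex.I) - p.1) (φ a, conj (φ s)) :=
    (hφ.analyticAt_apply_conjCoord_add (hrR hs) (IsConformalOn.vertical_mem_ball hr hR
      (conj_mem_ball_zero.2 hs) ⟨hr.le, le_rfl⟩)).sub analyticAt_fst
  have h2 := hφ.analyticAt_archIntegral hφ.conjConj hr hR ha (conj_mem_ball_zero.2 hs)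
  rw [conjConj_apply, Complex.conj_conj] at h2
  have h3 := analyticAt_partIntegral (Ω := Ω) hK (hKd a ha) (hKd s hs)
  refine (analyticAt_const.div h1 ?_).mul (analyticAt_const.mul (h2.add h3)).cexp
  simp only [hφ.conjCoord_conj (hrR hs)]
  exact hφ.kernelFactor_denom_ne_zero hr hR ha hs

/-- The factorization of the kernel at exterior points near a one-sided boundary arc. -/
theorem IsConformalOn.expKernel_eq (hφ : IsConformalOn φ (Metric.ball 0 R))
    (hr : 0 < r) (hR : 10 * r ≤ R) (hΩ : MeasurableSet Ω) (hΩb : Bornology.IsBounded Ω)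
    {K : Set ℂ} (hK : MeasurableSet K)
    (hΩK : Ω \ φ '' (Ioo (-(2 * r)) (2 * r) ×ℂ Ioo 0 r) = K ∩ Ω)
    (hup : φ '' (Ioo (-(2 * r)) (2 * r) ×ℂ Ioo 0 r) ⊆ Ω) {a s : ℂ}
    (ha : a ∈ Metric.ball 0 r) (hs : s ∈ Metric.ball 0 r) (ha' : a.im < 0) (hs' : s.im < 0)
    (haΩ : φ a ∉ closure Ω) (hsΩ : φ s ∉ closure Ω) :
    (φ a - φ (conj s)) * kernelFactor Ω K φ R r (φ a) (conj (φ s)) =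
      expKernel Ω (φ a) (conj (φ s)) := by
  have hrR : Metric.ball (0 : ℂ) r ⊆ Metric.ball 0 R := Metric.ball_subset_ball (by linarith)
  have hsub : Ioo (-(2 * r)) (2 * r) ×ℂ Ioo 0 r ⊆ Metric.ball (0 : ℂ) R := by
    intro x hx
    obtain ⟨⟨h1, h2⟩, h3, h4⟩ := Complex.mem_reProdIm.1 hx
    exact Complex.mem_ball_zero_of_abs_le (A := 2 * r) (B := r)
      (abs_le.2 ⟨h1.le, h2.le⟩) (abs_le.2 ⟨by linarith, h4.le⟩) (by linarith)
  have hopen : IsOpen (φ '' (Ioo (-(2 * r)) (2 * r) ×ℂ Ioo 0 r)) :=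
    (hφ.mono hsub).isOpen_image (isOpen_Ioo.reProdIm isOpen_Ioo)
  have hint : IntegrableOn (fun ζ : ℂ => 1 / ((ζ - φ a) * (conj ζ - conj (φ s)))) Ω :=
    ((continuousOn_cauchyKernel haΩ hsΩ).integrableOn_compact
      hΩb.isCompact_closure).mono_set subset_closure
  have hsplit : ∫ ζ in Ω, 1 / ((ζ - φ a) * (conj ζ - conj (φ s))) =
      sweepIntegral φ (_root_.conjConj φ) (fun x => (x : ℂ)) (-(2 * r)) (2 * r) r (φ a)
        (conj (φ s)) + partIntegral Ω K (φ a) (conj (φ s)) := by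
    rw [← hφ.integral_image_rect hsub, partIntegral, Measure.restrict_restrict hK, ← hΩK,
      ← setIntegral_union disjoint_sdiff_right (hΩ.diff hopen.measurableSet)
        (hint.mono_set hup) (hint.mono_set sdiff_subset), union_sdiff_cancel hup]
  have hE := hφ.exp_sweepIntegral_base hφ.conjConj hr hR ha (conj_mem_ball_zero.2 hs) ha'
    (by simpa using hs')
  rw [conjConj_apply, Complex.conj_conj] at hE
  have hd := hφ.kernelFactor_denom_ne_zero hr hR ha hs
  rw [expKernel, hsplit, mul_add, Complex.exp_add, hE, kernelFactor, mul_add, Complex.exp_add,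
    hφ.conjCoord_conj (hrR hs)]
  field_simp
  ring

theorem IsConformalOn.hasReflectionFactorization_of_oneSided
    (hφ : IsConformalOn φ (Metric.ball 0 R)) (hr : 0 < r) (hR : 10 * r ≤ R) (hΩ : IsOpen Ω)
    (hΩb : Bornology.IsBounded Ω)
    (hup : ∀ s ∈ Metric.ball 0 R, 0 < s.im → φ s ∈ Ω)
    (hlow : ∀ s ∈ Metric.ball 0 R, s.im < 0 → φ s ∉ closure Ω)
    (hreal : ∀ s ∈ Metric.ball 0 R, s.im = 0 → φ s ∈ frontier Ω) :
    HasReflectionFactorization Ω (φ '' Metric.ball 0 r) := by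
  have hrR : Metric.ball (0 : ℂ) r ⊆ Metric.ball 0 R := Metric.ball_subset_ball (by linarith)
  have hfr : ∀ s ∈ Metric.ball (0 : ℂ) R, φ s ∈ frontier Ω → s.im = 0 := by
    intro s hs h
    rcases lt_trichotomy s.im 0 with h' | h' | h'
    · exact absurd (frontier_subset_closure h) (hlow s hs h')
    · exact h'
    · rw [hΩ.frontier_eq] at h
      exact absurd (hup s hs h') h.2
  have him : ∀ s ∈ Metric.ball (0 : ℂ) R, φ s ∉ closure Ω → s.im < 0 := by
    intro s hs h
    rcases lt_trichotomy s.im 0 with h' | h' | h'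
    · exact h'
    · exact absurd (frontier_subset_closure (hreal s hs h')) h
    · exact absurd (subset_closure (hup s hs h')) h
  have hsub : Ioo (-(2 * r)) (2 * r) ×ℂ Ioo (-r) r ⊆ Metric.ball (0 : ℂ) R := by
    intro x hx
    obtain ⟨⟨h1, h2⟩, h3, h4⟩ := Complex.mem_reProdIm.1 hx
    exact Complex.mem_ball_zero_of_abs_le (A := 2 * r) (B := r)
      (abs_le.2 ⟨h1.le, h2.le⟩) (abs_le.2 ⟨h3.le, h4.le⟩) (by linarith)
  have hsub' : Ioo (-(2 * r)) (2 * r) ×ℂ Ioo 0 r ⊆ Ioo (-(2 * r)) (2 * r) ×ℂ Ioo (-r) r :=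
    fun x hx => ⟨hx.1, (by linarith [hx.2.1] : -r < x.im), hx.2.2⟩
  -- The rectangle extends below the axis so that `O` is an open neighbourhood of the arc. Then
  -- `closure Ω \ O` is compact and misses `φ '' ball 0 r`. Inside `Ω` only its upper half counts.
  set O := φ '' (Ioo (-(2 * r)) (2 * r) ×ℂ Ioo (-r) r) with hO
  have hOopen : IsOpen O := (hφ.mono hsub).isOpen_image (isOpen_Ioo.reProdIm isOpen_Ioo)
  have hK : IsCompact (closure Ω \ O) := hΩb.isCompact_closure.diff hOopen
  have hKd : ∀ s ∈ Metric.ball (0 : ℂ) r, φ s ∉ closure Ω \ O := by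
    intro s hs h
    have hs' := mem_ball_zero_iff.1 hs
    have h1 := abs_lt.1 ((Complex.abs_re_le_norm s).trans_lt hs')
    have h2 := abs_lt.1 ((Complex.abs_im_le_norm s).trans_lt hs')
    exact h.2 ⟨s, ⟨⟨by linarith, by linarith⟩, h2⟩, rfl⟩
  have hΩK : Ω \ φ '' (Ioo (-(2 * r)) (2 * r) ×ℂ Ioo 0 r) = (closure Ω \ O) ∩ Ω := by
    ext ζ
    constructor
    · rintro ⟨h1, h2⟩
      refine ⟨⟨subset_closure h1, ?_⟩, h1⟩
      rintro ⟨s, hs, rfl⟩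
      refine h2 ⟨s, ⟨hs.1, ?_, hs.2.2⟩, rfl⟩
      rcases lt_trichotomy s.im 0 with h' | h' | h'
      · exact absurd (subset_closure h1) (hlow s (hsub hs) h')
      · have := hreal s (hsub hs) h'
        rw [hΩ.frontier_eq] at this
        exact absurd h1 this.2
      · exact h'
    · rintro ⟨h1, h2⟩
      exact ⟨h2, fun h => h1.2 (image_mono hsub' h)⟩
  have hupr : φ '' (Ioo (-(2 * r)) (2 * r) ×ℂ Ioo 0 r) ⊆ Ω := by
    rintro _ ⟨s, hs, rfl⟩
    exact hup s (hsub (hsub' hs)) hs.2.1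
  have hpt : ∀ p : ℂ × ℂ, p ∈ {p : ℂ × ℂ | p.1 ∈ φ '' Metric.ball 0 r ∧
      conj p.2 ∈ φ '' Metric.ball 0 r} → ∃ a ∈ Metric.ball (0 : ℂ) r,
      ∃ s ∈ Metric.ball (0 : ℂ) r, p = (φ a, conj (φ s)) := by
    rintro ⟨z, v⟩ ⟨⟨a, ha, e1⟩, s, hs, e2⟩
    refine ⟨a, ha, s, hs, ?_⟩
    rw [e2, Complex.conj_conj, e1]
  refine ⟨fun z v => (z - φ (conjCoord φ (Metric.ball 0 R) v)) *
      kernelFactor Ω (closure Ω \ O) φ R r z v, ⟨?_, ?_⟩,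
    conformalReflection φ (Metric.ball 0 R), ⟨?_, ?_⟩,
    kernelFactor Ω (closure Ω \ O) φ R r, ?_, ?_, ?_⟩
  · intro p hp
    obtain ⟨a, ha, s, hs, rfl⟩ := hpt p hp
    refine AnalyticAt.mul (analyticAt_fst.sub ?_)
      (hφ.analyticAt_kernelFactor hr hR hK hKd ha hs)
    simpa using hφ.analyticAt_apply_conjCoord_add (c := 0) (z := φ a) (hrR hs)
      (by simpa using hrR hs)
  · rintro _ ⟨⟨a, ha, rfl⟩, haΩ⟩ _ ⟨⟨s, hs, rfl⟩, hsΩ⟩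
    rw [hφ.conjCoord_conj (hrR hs)]
    exact hφ.expKernel_eq hr hR hΩ.measurableSet hΩb hK.measurableSet hΩK hupr ha hs
      (him a (hrR ha) haΩ) (him s (hrR hs) hsΩ) haΩ hsΩ
  · exact (hφ.isSchwarzReflection hfr).antianalytic.mono (image_mono hrR)
  · exact fun z hz => (hφ.isSchwarzReflection hfr).fixes z ⟨image_mono hrR hz.1, hz.2⟩
  · intro p hp
    obtain ⟨a, ha, s, hs, rfl⟩ := hpt p hp
    exact hφ.analyticAt_kernelFactor hr hR hK hKd ha hs
  · rintro _ ⟨a, ha, rfl⟩ _ ⟨s, hs, rfl⟩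
    refine mul_ne_zero (div_ne_zero (by simp) ?_) (Complex.exp_ne_zero _)
    rw [hφ.conjCoord_conj (hrR hs)]
    exact hφ.kernelFactor_denom_ne_zero hr hR ha hs
  · intro z _ w _
    simp only [apply_conjCoord_conj (φ := φ)]

end OneSided

/-- Near an arc with `Ω` on both sides there is no exterior point, and nothing to extend. -/
theorem IsConformalOn.hasReflectionFactorization_of_twoSided {Ω : Set ℂ} {φ : ℂ → ℂ} {R : ℝ}
    (hφ : IsConformalOn φ (Metric.ball 0 R)) (hcl : φ '' Metric.ball 0 R ⊆ closure Ω)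
    (hΓ : ∀ s ∈ Metric.ball 0 R, φ s ∈ frontier Ω → s.im = 0) :
    HasReflectionFactorization Ω (φ '' Metric.ball 0 R) := by
  refine ⟨fun z v => z - φ (conjCoord φ (Metric.ball 0 R) v), ⟨?_, ?_⟩,
    conformalReflection φ (Metric.ball 0 R), hφ.isSchwarzReflection hΓ, fun _ _ => 1,
    fun _ _ => analyticAt_const, fun _ _ _ _ => one_ne_zero, fun z _ w _ => ?_⟩
  · rintro ⟨z, v⟩ ⟨_, s, hs, e⟩
    have e' : v = conj (φ s) := by rw [e, Complex.conj_conj]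
    subst e'
    refine analyticAt_fst.sub ?_
    simpa using hφ.analyticAt_apply_conjCoord_add (c := 0) (z := z) hs (by simpa using hs)
  · exact fun z hz => absurd (hcl hz.1) hz.2
  · simp only [apply_conjCoord_conj (φ := φ), mul_one]

/-! ### Straightening an analytic arc -/

/-- A real analytic curve is the restriction of a complex analytic function. -/
theorem AnalyticAt.exists_complexification {γ : ℝ → ℂ} {t₀ : ℝ} (h : AnalyticAt ℝ γ t₀) :
    ∃ φ : ℂ → ℂ, AnalyticAt ℂ φ 0 ∧ deriv φ 0 = deriv γ t₀ ∧
      ∀ᶠ s : ℝ in 𝓝 0, φ s = γ (t₀ + s) := by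
  obtain ⟨p, r, hp⟩ := h
  -- The same coefficients are used with a complex variable. Their norms are unchanged, so the
  -- radius does not shrink.
  let q : FormalMultilinearSeries ℂ ℂ ℂ := FormalMultilinearSeries.ofScalars ℂ p.coeff
  have hrad : p.radius ≤ q.radius := FormalMultilinearSeries.radius_le_of_le fun n => by
    rw [FormalMultilinearSeries.ofScalars_norm, FormalMultilinearSeries.norm_apply_eq_norm_coef]
  have hrq : r ≤ q.radius := hp.r_le.trans hrad
  have hq := q.hasFPowerSeriesOnBall (hp.r_pos.trans_le hrq)
  refine ⟨q.sum, hq.analyticAt, ?_, ?_⟩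
  · rw [hq.hasFPowerSeriesAt.hasStrictDerivAt.hasDerivAt.deriv,
      hp.hasFPowerSeriesAt.hasStrictDerivAt.hasDerivAt.deriv]
    simp [q]
  · filter_upwards [Metric.eball_mem_nhds (0 : ℝ) hp.r_pos] with s hs
    have h1 := hp.hasSum hs
    have hs' : (s : ℂ) ∈ Metric.eball (0 : ℂ) q.radius := by
      refine Metric.eball_subset_eball hrq ?_
      simpa [Metric.mem_eball, edist_zero_right, enorm_eq_nnnorm] using hs
    have h2 := hq.hasSum hs'
    rw [zero_add] at h2
    refine h2.unique ?_
    convert h1 using 2 with n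
    simp [q, mul_comm]

theorem AnalyticAt.eventually_isConformalOn_ball {φ : ℂ → ℂ} (h : AnalyticAt ℂ φ 0)
    (h0 : deriv φ 0 ≠ 0) : ∃ R > 0, IsConformalOn φ (Metric.ball 0 R) := by
  have hs := h.hasStrictDerivAt
  have e1 : ∀ᶠ x in 𝓝 (0 : ℂ), AnalyticAt ℂ φ x := h.eventually_analyticAt
  have e2 : ∀ᶠ x in 𝓝 (0 : ℂ), deriv φ x ≠ 0 := h.deriv.continuousAt.eventually_ne h0
  have e3 := (hs.hasStrictFDerivAt_equiv h0).eventually_left_inverse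
  obtain ⟨R, hR, hball⟩ := Metric.eventually_nhds_iff_ball.1 (e1.and (e2.and e3))
  refine ⟨R, hR, fun x hx => (hball x hx).1.differentiableAt.differentiableWithinAt,
    fun x hx y hy e => ?_, fun x hx => (hball x hx).2.1⟩
  rw [← (hball x hx).2.2, ← (hball y hy).2.2, e]

/-- A smooth analytic curve is straightened by a conformal map. -/
theorem IsSmoothAnalyticCurveNear.exists_isConformalOn {S : Set ℂ} {p : ℂ}
    (h : IsSmoothAnalyticCurveNear S p) (hp : p ∈ S) :
    ∃ (φ : ℂ → ℂ) (R : ℝ), 0 < R ∧ IsConformalOn φ (Metric.ball 0 R) ∧ φ 0 = p ∧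
      ∀ s ∈ Metric.ball 0 R, φ s ∈ S ↔ s.im = 0 := by
  obtain ⟨V, hV, hpV, a, b, γ, hγ, hγ', hemb, himg⟩ := h
  obtain ⟨t₀, ht₀, rfl⟩ : p ∈ γ '' Ioo a b := himg ▸ ⟨hp, hpV⟩
  obtain ⟨φ, hφ, hφ', hφγ⟩ := (hγ t₀ ht₀).exists_complexification
  obtain ⟨R₀, hR₀, hconf⟩ := hφ.eventually_isConformalOn_ball (hφ' ▸ hγ' t₀ ht₀)
  have hφ0 : φ 0 = γ t₀ := by simpa using hφγ.self_of_nhds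
  have hev : ∀ᶠ s : ℝ in 𝓝 0, φ s = γ (t₀ + s) ∧ t₀ + s ∈ Ioo a b := by
    refine hφγ.and ?_
    have : ContinuousAt (fun s : ℝ => t₀ + s) 0 := by fun_prop
    exact this.preimage_mem_nhds (isOpen_Ioo.mem_nhds (by simpa using ht₀))
  obtain ⟨R₁, hR₁, hball⟩ := Metric.eventually_nhds_iff_ball.1 hev
  have hR₂ : 0 < min R₀ R₁ := lt_min hR₀ hR₁
  -- The embedding property prevents the curve from returning near `p` at distant parameters. Hence
  -- a nearby point `φ s` of `S` has a parameter close to `t₀`, and injectivity of `φ` makes `s`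
  -- real.
  have hnhds : {t : Ioo a b | |(t : ℝ) - t₀| < min R₀ R₁} ∈ 𝓝 (⟨t₀, ht₀⟩ : Ioo a b) := by
    refine IsOpen.mem_nhds (isOpen_lt (by fun_prop) continuous_const) ?_
    simpa using hR₂
  rw [hemb.isInducing.nhds_eq_comap, Filter.mem_comap] at hnhds
  obtain ⟨W, hW, hWsub⟩ := hnhds
  have hW' : W ∩ V ∈ 𝓝 (φ 0) := by
    rw [hφ0]
    exact Filter.inter_mem hW (hV.mem_nhds hpV)
  obtain ⟨R₃, hR₃, hmaps⟩ := Metric.mem_nhds_iff.1 (hφ.continuousAt.preimage_mem_nhds hW')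
  have hle : Metric.ball (0 : ℂ) (min (min R₀ R₁) R₃) ⊆ Metric.ball 0 R₀ :=
    Metric.ball_subset_ball ((min_le_left _ _).trans (min_le_left _ _))
  refine ⟨φ, min (min R₀ R₁) R₃, lt_min hR₂ hR₃, hconf.mono hle, hφ0, fun s hs => ?_⟩
  constructor
  · intro hsS
    have hsW := hmaps (Metric.ball_subset_ball (min_le_right _ _) hs)
    obtain ⟨t, ht, hts⟩ : φ s ∈ γ '' Ioo a b := himg ▸ ⟨hsS, hsW.2⟩
    have htR : |t - t₀| < min R₀ R₁ := hWsub (a := ⟨t, ht⟩) (by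
      rw [mem_preimage, domRestrict_apply, hts]
      exact hsW.1)
    have h1 := (hball (t - t₀) (by
      rw [mem_ball_zero_iff, Real.norm_eq_abs]
      exact htR.trans_le (min_le_right _ _))).1
    rw [add_sub_cancel, hts] at h1
    have h2 := hconf.injOn (by
      rw [mem_ball_zero_iff, Complex.norm_real, Real.norm_eq_abs]
      exact htR.trans_le (min_le_left _ _)) (hle hs) h1
    rw [← h2, Complex.ofReal_im]
  · intro him
    have hs' : s = (s.re : ℂ) := Complex.ext rfl (by simpa using him)
    obtain ⟨h1, h2⟩ := hball s.re (by
      rw [mem_ball_zero_iff] at hs ⊢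
      exact (Complex.abs_re_le_norm s).trans_lt
        (hs.trans_le ((min_le_left _ _).trans (min_le_right _ _))))
    rw [hs', h1]
    exact (himg ▸ mem_image_of_mem γ h2 : γ (t₀ + s.re) ∈ S ∩ V).1

/-- A convex set mapped off the frontier of an open set lies on one side of it. -/
theorem image_subset_or_disjoint_closure {Ω H : Set ℂ} {φ : ℂ → ℂ} (hΩ : IsOpen Ω)
    (hH : Convex ℝ H) (hφ : ContinuousOn φ H) (h : ∀ s ∈ H, φ s ∉ frontier Ω) :
    (∀ s ∈ H, φ s ∈ Ω) ∨ ∀ s ∈ H, φ s ∉ closure Ω := by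
  have hd : Disjoint Ω (closure Ω)ᶜ := disjoint_compl_right.mono_left subset_closure
  have hsub : φ '' H ⊆ Ω ∪ (closure Ω)ᶜ := by
    rintro _ ⟨s, hs, rfl⟩
    by_contra hc
    simp only [mem_union, mem_compl_iff, not_or, not_not] at hc
    exact h s hs (hΩ.frontier_eq ▸ ⟨hc.2, hc.1⟩)
  rcases (hH.isPreconnected.image φ hφ).subset_or_subset hΩ isClosed_closure.isOpen_compl hd hsub
    with h' | h'
  · exact Or.inl fun s hs => h' (mem_image_of_mem φ hs)
  · exact Or.inr fun s hs => h' (mem_image_of_mem φ hs)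

theorem IsConformalOn.comp_neg {φ : ℂ → ℂ} {R : ℝ} (hφ : IsConformalOn φ (Metric.ball 0 R)) :
    IsConformalOn (fun s => φ (-s)) (Metric.ball 0 R) where
  differentiableOn := hφ.differentiableOn.comp (by fun_prop) fun s hs => by simpa using hs
  injOn := fun s hs t ht e =>
    neg_injective (hφ.injOn (by simpa using hs) (by simpa using ht) e)
  deriv_ne_zero := fun s hs => by
    rw [deriv_comp_neg]
    exact neg_ne_zero.2 (hφ.deriv_ne_zero _ (by simpa using hs))

/-! ### Case analysis on the two sides, and conclusion -/

theorem exists_hasReflectionFactorization {Ω : Set ℂ} (hΩ : IsOpen Ω)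
    (hΩb : Bornology.IsBounded Ω) {p : ℂ} (hp : p ∈ frontier Ω)
    (hs : IsSmoothAnalyticCurveNear (frontier Ω) p) :
    ∃ (φ : ℂ → ℂ) (r : ℝ), 0 < r ∧ IsConformalOn φ (Metric.ball 0 r) ∧ φ 0 = p ∧
      HasReflectionFactorization Ω (φ '' Metric.ball 0 r) := by
  obtain ⟨φ, R, hR, hφ, hφ0, hfr⟩ := hs.exists_isConformalOn hp
  have h10 : 10 * (R / 10) ≤ R := by linarith
  have hr : 0 < R / 10 := by positivity
  have hrR : Metric.ball (0 : ℂ) (R / 10) ⊆ Metric.ball 0 R :=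
    Metric.ball_subset_ball (by linarith)
  have hU : Convex ℝ (Metric.ball (0 : ℂ) R ∩ {s | 0 < s.im}) :=
    (convex_ball 0 R).inter (convex_halfSpace_im_gt 0)
  have hL : Convex ℝ (Metric.ball (0 : ℂ) R ∩ {s | s.im < 0}) :=
    (convex_ball 0 R).inter (convex_halfSpace_im_lt 0)
  have hreal : ∀ s ∈ Metric.ball 0 R, s.im = 0 → φ s ∈ frontier Ω :=
    fun s hs h => (hfr s hs).2 h
  have upper := image_subset_or_disjoint_closure hΩ hU
    (hφ.differentiableOn.continuousOn.mono inter_subset_left)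
    fun s hs h => hs.2.ne' ((hfr s hs.1).1 h)
  have lower := image_subset_or_disjoint_closure hΩ hL
    (hφ.differentiableOn.continuousOn.mono inter_subset_left)
    fun s hs h => hs.2.ne ((hfr s hs.1).1 h)
  rcases upper with hu | hu <;> rcases lower with hl | hl
  · refine ⟨φ, R, hR, hφ, hφ0, hφ.hasReflectionFactorization_of_twoSided ?_
      fun s hs => (hfr s hs).1⟩
    rintro _ ⟨s, hs, rfl⟩
    rcases lt_trichotomy s.im 0 with h' | h' | h'
    · exact subset_closure (hl s ⟨hs, h'⟩)
    · exact frontier_subset_closure (hreal s hs h')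
    · exact subset_closure (hu s ⟨hs, h'⟩)
  · exact ⟨φ, R / 10, hr, hφ.mono hrR, hφ0, hφ.hasReflectionFactorization_of_oneSided hr h10 hΩ
      hΩb (fun s hs h => hu s ⟨hs, h⟩) (fun s hs h => hl s ⟨hs, h⟩) hreal⟩
  -- Turning the coordinate by `s ↦ -s` exchanges the half discs.
  · have hmem : ∀ s ∈ Metric.ball (0 : ℂ) R, -s ∈ Metric.ball (0 : ℂ) R := fun s hs => by
      simpa using hs
    refine ⟨fun s => φ (-s), R / 10, hr, hφ.comp_neg.mono hrR, by simpa using hφ0,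
      hφ.comp_neg.hasReflectionFactorization_of_oneSided hr h10 hΩ hΩb
        (fun s hs h => hl (-s) ⟨hmem s hs, ?_⟩) (fun s hs h => hu (-s) ⟨hmem s hs, ?_⟩)
        (fun s hs h => hreal (-s) (hmem s hs) ?_)⟩ <;> simpa using h
  -- With both sides exterior, a whole neighbourhood of `p` would miss the open set `Ω`, although
  -- `p` lies in its closure.
  · exfalso
    have hopen : IsOpen (φ '' Metric.ball 0 R) := hφ.isOpen_image Metric.isOpen_ball
    have hmem : p ∈ φ '' Metric.ball 0 R := ⟨0, Metric.mem_ball_self hR, hφ0⟩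
    obtain ⟨_, ⟨s, hs, rfl⟩, hsΩ⟩ :=
      mem_closure_iff.1 (frontier_subset_closure hp) _ hopen hmem
    rcases lt_trichotomy s.im 0 with h' | h' | h'
    · exact hl s ⟨hs, h'⟩ (subset_closure hsΩ)
    · have := hreal s hs h'
      rw [hΩ.frontier_eq] at this
      exact this.2 hsΩ
    · exact hu s ⟨hs, h'⟩ (subset_closure hsΩ)

theorem theorem3p3 (Ω : Set ℂ) (hΩ_open : IsOpen Ω) (hΩ_conn : IsConnected Ω)
    (hΩ_bdd : Bornology.IsBounded Ω) (p : ℂ) (hp : p ∈ frontier Ω)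
    (hp_smooth : IsSmoothAnalyticCurveNear (frontier Ω) p) :
    ∃ U : Set ℂ, IsOpen U ∧ IsConnected U ∧ p ∈ U ∧
      ∃ F : ℂ → ℂ → ℂ, IsAnalyticExtension Ω U F ∧
        -- the extension is unique (as soon as there is something to extend)
        ((U \ closure Ω).Nonempty → ∀ G : ℂ → ℂ → ℂ, IsAnalyticExtension Ω U G →
          ∀ z ∈ U, ∀ w ∈ U, G z (conj w) = F z (conj w)) ∧
        ∃ σ : ℂ → ℂ, IsSchwarzReflection (frontier Ω) U σ ∧
          ∃ f : ℂ → ℂ → ℂ, AnalyticInConj f U ∧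
            (∀ z ∈ U, ∀ w ∈ U, f z (conj w) ≠ 0) ∧
            ∀ z ∈ U, ∀ w ∈ U, F z (conj w) = (z - σ w) * f z (conj w) := by
  obtain ⟨φ, r, hr, hφ, hφ0, F, hF, hrest⟩ :=
    exists_hasReflectionFactorization hΩ_open hΩ_bdd hp hp_smooth
  have hU : IsOpen (φ '' Metric.ball 0 r) := hφ.isOpen_image Metric.isOpen_ball
  have h0 : (0 : ℂ) ∈ Metric.ball (0 : ℂ) r := Metric.mem_ball_self hr
  have hUc : IsConnected (φ '' Metric.ball 0 r) :=
    ⟨⟨φ 0, mem_image_of_mem φ h0⟩,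
      (convex_ball (0 : ℂ) r).isPreconnected.image φ hφ.differentiableOn.continuousOn⟩
  exact ⟨_, hU, hUc, ⟨0, h0, hφ0⟩, F, hF,
    fun hne G hG z hz w hw => hF.eq_of_nonempty hU hUc hG hne hz hw, hrest⟩
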